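/- For $x \in \mathbb{R}^2$ and $e \in S^1$ write $\ell_{x,e} = x + \mathrm{span}(e)$. For $t \in (1,2]$ let $\gamma(t) \in [0,1]$ be the infimum of those $\gamma \in [0,1]$ for which the following holds: for every compact $K \subset \mathbb{R}^2$ with $\mathcal{H}^t(K) < \infty$ there is a set $E \subset S^1$ with $\dim_{\mathrm{H}} E \le \gamma$ such that, for $\mathcal{H}^t$-almost every $x \in K$, we have $|K \cap \ell_{x,e}| \ge 2$ for all $e \in S^1 \setminus E$. Then $\gamma(t) = 1$ for every $t \in (1,2)$. In particular, for every $t \in (1,2)$ the following assertion is false: for every compact $K \subset \mathbb{R}^2$ with $0 < \mathcal{H}^t(K) < \infty$ there is a set $E \subset S^1$ with $\dim_{\mathrm{H}} E \le 2 - t$ such that, for $\mathcal{H}^t$-almost every $x \in K$, we have $\dim_{\mathrm{H}}(K \cap \ell_{x,e}) \ge t - 1$ for all $e \in S^1 \setminus E$. -/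

import Mathlib

open MeasureTheory Set

/-- The Euclidean plane. -/
abbrev Plane : Type := EuclideanSpace ℝ (Fin 2)

/-- The unit circle of directions. -/
def unitCircle : Set Plane := Metric.sphere 0 1

/-- The line `x + span e`. -/
def lineThrough (x e : Plane) : Set Plane :=
  (AffineSubspace.mk' x (Submodule.span ℝ {e}) : Set Plane)

/-- `γ` is admissible for `t`: for each compact `K` with finite `t`-dimensional Hausdorff measure
there is one exceptional set `E` of directions, of dimension at most `γ`, such that, for almost
every `x ∈ K`, every line through `x` with direction outside `E` meets `K` in at least two
points. -/
def Admissible (t γ : ℝ) : Prop :=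
  ∀ K : Set Plane, IsCompact K → μH[t] K < ⊤ →
    ∃ E : Set Plane, E ⊆ unitCircle ∧ dimH E ≤ ENNReal.ofReal γ ∧
      ∀ᵐ x ∂(μH[t] : Measure Plane), x ∈ K →
        ∀ e ∈ unitCircle \ E, 2 ≤ (K ∩ lineThrough x e).encard

/-- The infimum of the admissible exponents in `[0,1]`. -/
noncomputable def gammaExponent (t : ℝ) : ℝ :=
  sInf {γ : ℝ | γ ∈ Icc (0 : ℝ) 1 ∧ Admissible t γ}

/-- The uniform exceptional set estimate for slices through points of `K`: for each compact `K`
with positive and finite `t`-dimensional Hausdorff measure there is one set `E` of directions, of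
dimension at most `2 - t`, such that, for almost every `x ∈ K`, every line through `x` with
direction outside `E` meets `K` in a set of dimension at least `t - 1`. -/
def UniformSliceEstimate (t : ℝ) : Prop :=
  ∀ K : Set Plane, IsCompact K → 0 < μH[t] K → μH[t] K < ⊤ →
    ∃ E : Set Plane, E ⊆ unitCircle ∧ dimH E ≤ ENNReal.ofReal (2 - t) ∧
      ∀ᵐ x ∂(μH[t] : Measure Plane), x ∈ K →
        ∀ e ∈ unitCircle \ E, ENNReal.ofReal (t - 1) ≤ dimH (K ∩ lineThrough x e)

/-! Write `t = 1 + τ` and fix `γ < 1`. The counterexample is a projective image of `C × Y`, where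
`C` is a Cantor set of dimension `τ` and `Y ⊆ [0,1]` is compact of positive length. Many of its
points `x` lie on a line that meets the set only at `x`, and the directions of these lines avoid
almost surely any given set of dimension at most `γ`.

Up to relative errors `ε i` with small sum, the nonzero differences of `C` form a sequence `μ i`.
`Y` is `[0,1]` without the `8 ε i ρ i`-neighbourhoods of `ρ i * ℤ`. For each height `y` a slope
`a(y)` is built as a series of corrections. The `i`-th one moves `y + μ i * a` next to `ρ i * ℤ`;
earlier partial slopes only add near-multiples of `ρ i`, and later corrections are negligible. Hence
the line of slope `a(y)` through `(c, y)` is at a forbidden height over every other point of `C`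
(`ScaleData.exists_abs_sub_lt`).

The slopes `a(y)` themselves are covered by few short intervals, so they could all be exceptional.
The projective map `projMap` repairs this: the image line has slope `y - (1 + c) * a(y)`, the height
of the source line over `-1`. Since `a` is nearly constant on few pieces, for fixed `c` this is
nearly a translation of `y` on each piece. It therefore sends Lebesgue measure to a measure
absolutely continuous with respect to `μH[1 - 1/M]` (`ScaleData.volume_preimage_le_rpow`). Taking `γ
< 1 - 1/M` and applying Fubini, almost every point has its singleton line outside `E`
(`not_admissible_of_lt_one`). -/

/-! ### Mass distribution principle. -/

open scoped ENNReal NNReal in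
/-- A mass distribution principle: a measure whose value on small closed sets is controlled by a
power of the diameter is absolutely continuous with respect to the Hausdorff measure. -/
theorem absolutelyContinuous_hausdorffMeasure_of_ediam {X : Type*} [EMetricSpace X]
    [MeasurableSpace X] [BorelSpace X] {d : ℝ} (hd : 0 < d) (ν : Measure X) (L : ℝ≥0) {r₀ : ℝ}
    (hr₀ : 0 < r₀)
    (h : ∀ (s : Set X) (r : ℝ), IsClosed s → 0 < r → r ≤ r₀ → Metric.ediam s ≤ ENNReal.ofReal r →
      ν s ≤ L * ENNReal.ofReal r ^ d) : ν ≪ (μH[d] : Measure X) := by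
  have key : ∀ s : Set X, Metric.ediam s ≤ ENNReal.ofReal r₀ → ν s ≤ L * Metric.ediam s ^ d := by
    intro s hs
    have hfin : Metric.ediam s ≠ ⊤ := ne_top_of_le_ne_top ENNReal.ofReal_ne_top hs
    refine (measure_mono subset_closure).trans ?_
    rcases eq_or_ne (Metric.ediam s) 0 with h0 | h0
    -- The hypothesis only covers radii `r > 0`, so sets of diameter zero are reached by letting `r
    -- → 0`.
    · rw [h0, ENNReal.zero_rpow_of_pos hd, mul_zero]
      have hlim : Filter.Tendsto (fun r : ℝ => (L : ℝ≥0∞) * ENNReal.ofReal r ^ d)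
          (nhdsWithin 0 (Ioi 0)) (nhds 0) := by
        have h1 : Filter.Tendsto (fun r : ℝ => ENNReal.ofReal r) (nhdsWithin 0 (Ioi 0))
            (nhds 0) := by
          have := (ENNReal.continuous_ofReal.tendsto 0).mono_left
            (nhdsWithin_le_nhds (s := Ioi (0 : ℝ)))
          simpa using this
        have h2 := ((ENNReal.continuous_rpow_const (y := d)).tendsto 0).comp h1
        rw [ENNReal.zero_rpow_of_pos hd] at h2
        have h3 := ENNReal.Tendsto.const_mul (a := (L : ℝ≥0∞)) h2 (Or.inr ENNReal.coe_ne_top)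
        simpa using h3
      refine ge_of_tendsto hlim ?_
      filter_upwards [Ioc_mem_nhdsGT hr₀] with r hr
      refine h _ r isClosed_closure hr.1 hr.2 ?_
      rw [Metric.ediam_closure, h0]
      exact bot_le
    · have hr : ENNReal.ofReal (Metric.ediam s).toReal = Metric.ediam s :=
        ENNReal.ofReal_toReal hfin
      have := h (closure s) (Metric.ediam s).toReal isClosed_closure
        (ENNReal.toReal_pos h0 hfin)
        (by
          have := ENNReal.toReal_mono ENNReal.ofReal_ne_top hs
          rwa [ENNReal.toReal_ofReal hr₀.le] at this)
        (by rw [Metric.ediam_closure, hr])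
      rwa [hr] at this
  -- `L + 1` replaces `L` so that the constant is invertible even when `L = 0`.
  have hle : ((L : ℝ≥0∞) + 1)⁻¹ • ν ≤ (μH[d] : Measure X) := by
    refine Measure.le_hausdorffMeasure d _ (ENNReal.ofReal r₀) (ENNReal.ofReal_pos.2 hr₀) ?_
    intro s hs
    rw [Measure.smul_apply, smul_eq_mul]
    calc ((L : ℝ≥0∞) + 1)⁻¹ * ν s ≤ ((L : ℝ≥0∞) + 1)⁻¹ * (((L : ℝ≥0∞) + 1) * Metric.ediam s ^ d) := by
          gcongr
          exact (key s hs).trans (by gcongr; exact le_self_add)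
      _ = Metric.ediam s ^ d := by
          rw [← mul_assoc, ENNReal.inv_mul_cancel (by simp) (by simp), one_mul]
  intro s hs
  have h1 := hle s
  rw [hs, Measure.smul_apply, smul_eq_mul, nonpos_iff_eq_zero, mul_eq_zero] at h1
  rcases h1 with h1 | h1
  · simp at h1
  · exact h1

/-! ### Scales and the slope function. -/

/-- Scales for the construction of lines avoiding a product set over `C`: a sequence of
approximate differences `μ i` of `C` with relative precision `ε i`, together with
denominators `A i`, `S i` such that `C` lies close to `(S i)⁻¹ ℤ`. -/
structure ScaleData (C : Set ℝ) (M : ℕ) where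
  ε : ℕ → ℝ
  μ : ℕ → ℝ
  A : ℕ → ℕ
  S : ℕ → ℕ
  q : ℕ → ℕ
  v : ℕ → ℕ
  ε_pos : ∀ i, 0 < ε i
  ε_le : ∀ i, ε i ≤ 1
  μ_ne : ∀ i, μ i ≠ 0
  μ_le : ∀ i, |μ i| ≤ 1
  A_zero : A 0 = 1
  A_succ : ∀ i, A (i + 1) = A i * S i * q i
  S_pos : ∀ i, 0 < S i
  le_q : ∀ i, 1 ≤ q i * ε i
  le_v : ∀ i, q i / |μ i| + 1 ≤ v i
  S_large : ∀ i, (2 : ℝ) ^ (i + 2) * (∏ j ∈ Finset.range (i + 1), (2 * v j + 1 : ℝ)) ^ M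
    ≤ S i * |μ i|
  approx : ∀ i, ∀ c ∈ C, ∃ k : ℤ, |c - k / S i| ≤ ε i / (4 * A i * S i)

/-- The choices are not circular: `q` and `v` depend only on `ε` and `μ`, so the lower bound
required of `S i` is known in advance. Once `A i` is known, `S i` is chosen for the tolerance `ε i /
(4 * A i)`, and this fixes `A (i + 1)`. -/
theorem ScaleData.exists_of_approx {C : Set ℝ} (M : ℕ) (ε μ : ℕ → ℝ) (ε_pos : ∀ i, 0 < ε i)
    (ε_le : ∀ i, ε i ≤ 1) (μ_ne : ∀ i, μ i ≠ 0) (μ_le : ∀ i, |μ i| ≤ 1)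
    (happ : ∀ δ : ℝ, 0 < δ → ∀ B : ℝ, ∃ S : ℕ, B ≤ S ∧ ∀ c ∈ C, ∃ k : ℤ, |c - k / S| ≤ δ / S) :
    ∃ D : ScaleData C M, D.ε = ε ∧ D.μ = μ := by
  choose! f hfB hf using happ
  let q : ℕ → ℕ := fun i => ⌈1 / ε i⌉₊
  have hq : ∀ i, 1 ≤ q i * ε i := fun i => by
    have := Nat.le_ceil (1 / ε i)
    rwa [div_le_iff₀ (ε_pos i)] at this
  have hq0 : ∀ i, 0 < q i := fun i => Nat.ceil_pos.2 (one_div_pos.2 (ε_pos i))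
  let v : ℕ → ℕ := fun i => ⌈q i / |μ i| + 1⌉₊
  -- The maximum with `1` forces `S i` to be positive.
  let B : ℕ → ℝ := fun i =>
    max 1 ((2 : ℝ) ^ (i + 2) * (∏ j ∈ Finset.range (i + 1), (2 * v j + 1 : ℝ)) ^ M / |μ i|)
  let A : ℕ → ℕ := fun n => Nat.rec (motive := fun _ => ℕ) 1
    (fun i a => a * f (ε i / (4 * (a : ℝ))) (B i) * q i) n
  let S : ℕ → ℕ := fun i => f (ε i / (4 * (A i : ℝ))) (B i)
  have hA : ∀ i, A (i + 1) = A i * S i * q i := fun i => rfl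
  have hpos : ∀ i, 0 < A i ∧ 0 < S i := by
    have step : ∀ i, 0 < A i → 0 < S i := by
      intro i hi
      have : (0 : ℝ) < A i := by exact_mod_cast hi
      have h1 := hfB (ε i / (4 * A i)) (div_pos (ε_pos i) (by positivity)) (B i)
      have h2 : (1 : ℝ) ≤ B i := le_max_left _ _
      have h3 : (0 : ℝ) < S i := by
        show (0 : ℝ) < f (ε i / (4 * (A i : ℝ))) (B i)
        linarith
      exact_mod_cast h3
    intro i
    induction i with
    | zero => exact ⟨Nat.one_pos, step 0 Nat.one_pos⟩
    | succ i ih =>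
      have : 0 < A (i + 1) := by
        rw [hA]
        exact Nat.mul_pos (Nat.mul_pos ih.1 ih.2) (hq0 i)
      exact ⟨this, step _ this⟩
  have hδ : ∀ i, 0 < ε i / (4 * A i) := fun i => by
    have : (0 : ℝ) < A i := by exact_mod_cast (hpos i).1
    have := ε_pos i
    positivity
  refine ⟨⟨ε, μ, A, S, q, v, ε_pos, ε_le, μ_ne, μ_le, rfl, hA, fun i => (hpos i).2, hq,
    fun i => Nat.le_ceil _, ?_, ?_⟩, rfl, rfl⟩
  · intro i
    have h1 : B i ≤ S i := hfB _ (hδ i) (B i)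
    have h2 := (le_max_right _ _).trans h1
    rwa [div_le_iff₀ (abs_pos.2 (μ_ne i))] at h2
  · intro i c hc
    obtain ⟨k, hk⟩ := hf _ (hδ i) (B i) c hc
    refine ⟨k, hk.trans (le_of_eq ?_)⟩
    rw [div_div]

namespace ScaleData

variable {C : Set ℝ} {M : ℕ} (D : ScaleData C M)

/-- The period of the pattern attached to the `i`-th difference. -/
noncomputable def ρ (i : ℕ) : ℝ := 1 / (D.A i * D.S i)

/-- The bound for the `i`-th correction of the slope. -/
noncomputable def step (i : ℕ) : ℝ := 2 * D.ρ i / |D.μ i|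

/-- The bound for the number of values of the `i`-th partial slope. -/
noncomputable def count (i : ℕ) : ℝ := ∏ j ∈ Finset.range i, (2 * D.v j + 1 : ℝ)

/-- The correction that brings `y + μ i * slope` close to `ρ i * ℤ`. -/
noncomputable def shift (i : ℕ) (y : ℝ) : ℝ :=
  ⌊D.A (i + 1) * (-(D.ρ i * Int.fract (y / D.ρ i) / D.μ i))⌋ / D.A (i + 1)

noncomputable def partialSlope (i : ℕ) (y : ℝ) : ℝ := ∑ j ∈ Finset.range i, D.shift j y

noncomputable def slope (y : ℝ) : ℝ := ∑' i, D.shift i y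

theorem q_pos (i : ℕ) : (0 : ℝ) < D.q i := by
  have h1 := D.le_q i
  have h2 := D.ε_pos i
  by_contra h
  push Not at h
  nlinarith

theorem A_pos (i : ℕ) : 0 < D.A i := by
  induction i with
  | zero => rw [D.A_zero]; exact Nat.one_pos
  | succ i ih =>
    rw [D.A_succ]
    exact Nat.mul_pos (Nat.mul_pos ih (D.S_pos i)) (by exact_mod_cast D.q_pos i)

theorem A_cast_pos (i : ℕ) : (0 : ℝ) < D.A i := by exact_mod_cast D.A_pos i

theorem S_cast_pos (i : ℕ) : (0 : ℝ) < D.S i := by exact_mod_cast D.S_pos i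

theorem ρ_pos (i : ℕ) : 0 < D.ρ i := by
  have := D.A_cast_pos i
  have := D.S_cast_pos i
  unfold ρ
  positivity

theorem μ_pos (i : ℕ) : 0 < |D.μ i| := abs_pos.2 (D.μ_ne i)

theorem A_dvd {i j : ℕ} (h : i ≤ j) : D.A i ∣ D.A j := by
  induction j, h using Nat.le_induction with
  | base => exact dvd_rfl
  | succ j _ ih =>
    rw [D.A_succ, mul_assoc]
    exact ih.mul_right _

theorem A_mono {i j : ℕ} (h : i ≤ j) : (D.A i : ℝ) ≤ D.A j := by
  exact_mod_cast Nat.le_of_dvd (D.A_pos j) (D.A_dvd h)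

theorem one_div_A_succ (i : ℕ) : 1 / (D.A (i + 1) : ℝ) = D.ρ i / D.q i := by
  rw [D.A_succ, ρ]
  push_cast
  rw [div_div]

theorem one_div_A_succ_le (i : ℕ) : 1 / (D.A (i + 1) : ℝ) ≤ D.ε i * D.ρ i := by
  rw [D.one_div_A_succ, div_le_iff₀ (D.q_pos i)]
  have := D.le_q i
  have := D.ρ_pos i
  nlinarith

theorem count_pos (i : ℕ) : 0 < D.count i := Finset.prod_pos fun j _ => by positivity

theorem one_le_count (i : ℕ) : 1 ≤ D.count i := by
  refine Finset.prod_induction _ (fun x : ℝ => 1 ≤ x) (fun a b ha hb => ?_) le_rfl fun j _ => ?_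
  · exact one_le_mul_of_one_le_of_one_le ha hb
  · have : (0 : ℝ) ≤ D.v j := Nat.cast_nonneg _
    linarith

theorem count_mono {i j : ℕ} (h : i ≤ j) : D.count i ≤ D.count j := by
  induction j, h using Nat.le_induction with
  | base => exact le_rfl
  | succ j _ ih =>
    rw [count.eq_1 D (j + 1), Finset.prod_range_succ]
    refine ih.trans (le_mul_of_one_le_right (D.count_pos j).le ?_)
    have : (0 : ℝ) ≤ D.v j := Nat.cast_nonneg _
    linarith

theorem abs_raw_le (i : ℕ) (y : ℝ) :
    |-(D.ρ i * Int.fract (y / D.ρ i) / D.μ i)| ≤ D.ρ i / |D.μ i| := by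
  rw [abs_neg, abs_div, abs_mul, abs_of_pos (D.ρ_pos i), abs_of_nonneg (Int.fract_nonneg _)]
  gcongr
  · exact mul_le_of_le_one_right (D.ρ_pos i).le (Int.fract_lt_one _).le

theorem abs_shift_sub_le (i : ℕ) (y : ℝ) :
    |D.shift i y - -(D.ρ i * Int.fract (y / D.ρ i) / D.μ i)| ≤ 1 / D.A (i + 1) := by
  have hA := D.A_cast_pos (i + 1)
  set x := -(D.ρ i * Int.fract (y / D.ρ i) / D.μ i) with hx
  have h1 := Int.floor_le (D.A (i + 1) * x)
  have h2 := Int.lt_floor_add_one (D.A (i + 1) * x)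
  have h3 : D.shift i y - x = (⌊D.A (i + 1) * x⌋ - D.A (i + 1) * x) / D.A (i + 1) := by
    rw [shift, ← hx]
    field_simp
  rw [h3, abs_div, abs_of_pos hA]
  gcongr
  rw [abs_le]
  constructor <;> linarith

theorem abs_shift_le (i : ℕ) (y : ℝ) : |D.shift i y| ≤ D.step i := by
  have h1 := D.abs_raw_le i y
  have h2 := D.abs_shift_sub_le i y
  have h3 : 1 / (D.A (i + 1) : ℝ) ≤ D.ρ i / |D.μ i| := by
    refine (D.one_div_A_succ_le i).trans ?_
    rw [le_div_iff₀ (D.μ_pos i)]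
    have := D.ρ_pos i
    calc D.ε i * D.ρ i * |D.μ i| ≤ 1 * D.ρ i * 1 := by
          gcongr
          · exact D.ε_le i
          · exact D.μ_le i
      _ = D.ρ i := by ring
  have h4 := abs_sub_abs_le_abs_sub (D.shift i y) (-(D.ρ i * Int.fract (y / D.ρ i) / D.μ i))
  have h5 : D.step i = D.ρ i / |D.μ i| + D.ρ i / |D.μ i| := by
    rw [step]; ring
  linarith

/-- This is `S_large` rewritten. The factor `1 / A i` keeps later corrections from spoiling earlier
ones; the factor `1 / count ^ M` makes the slope take few values at each scale. -/
theorem step_le (i : ℕ) :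
    D.step i ≤ (1 / 2) ^ (i + 1) * (1 / (D.A i * D.count (i + 1) ^ M)) := by
  have hA := D.A_cast_pos i
  have hS := D.S_cast_pos i
  have hμ := D.μ_pos i
  have hc := D.count_pos (i + 1)
  have h := D.S_large i
  rw [← count] at h
  have h1 : D.step i = 2 / (D.A i * (D.S i * |D.μ i|)) := by
    rw [step, ρ]; field_simp
  rw [h1, one_div_pow, div_mul_div_comm, one_mul]
  rw [div_le_div_iff₀ (by positivity) (by positivity)]
  calc 2 * (2 ^ (i + 1) * (D.A i * D.count (i + 1) ^ M))
      = D.A i * (2 ^ (i + 2) * D.count (i + 1) ^ M) := by ring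
    _ ≤ D.A i * (D.S i * |D.μ i|) := by gcongr
    _ = 1 * (D.A i * (D.S i * |D.μ i|)) := by ring

theorem step_le_A {i j : ℕ} (h : i ≤ j) : D.step j ≤ (1 / 2) ^ (j + 1) * (1 / D.A i) := by
  refine (D.step_le j).trans ?_
  have hA := D.A_cast_pos i
  have := D.A_mono h
  have h1 : 1 ≤ D.count (j + 1) ^ M := one_le_pow₀ (D.one_le_count _)
  gcongr
  nlinarith

theorem step_le_count {i j : ℕ} (h : i ≤ j) :
    D.step j ≤ (1 / 2) ^ (j + 1) * (1 / D.count (i + 1) ^ M) := by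
  refine (D.step_le j).trans ?_
  have hc := D.count_pos (i + 1)
  have hc' := D.count_pos (j + 1)
  have h0 := D.A_mono (Nat.zero_le j)
  rw [D.A_zero, Nat.cast_one] at h0
  have h1 : D.count (i + 1) ^ M ≤ D.count (j + 1) ^ M := by
    gcongr
    exact D.count_mono (by omega)
  have h2 : 0 < D.count (j + 1) ^ M := by positivity
  gcongr
  nlinarith

theorem step_le_half (j : ℕ) : D.step j ≤ (1 / 2) ^ (j + 1) := by
  have := D.step_le_A (Nat.zero_le j)
  simpa [D.A_zero] using this

theorem summable_shift (y : ℝ) : Summable fun i => D.shift i y := by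
  refine Summable.of_norm_bounded (g := fun i : ℕ => (1 / 2 : ℝ) ^ (i + 1)) ?_ ?_
  · exact (summable_nat_add_iff 1).2 (summable_geometric_of_lt_one (by norm_num) (by norm_num))
  · intro i
    exact (D.abs_shift_le i y).trans (D.step_le_half i)

/-- A geometric tail; `b` is left free to serve both `step_le_A` and `step_le_count`. -/
theorem abs_slope_sub_le {b : ℝ} {i : ℕ} (hb : ∀ j, i ≤ j → D.step j ≤ (1 / 2) ^ (j + 1) * b)
    (y : ℝ) : |D.slope y - D.partialSlope i y| ≤ (1 / 2) ^ i * b := by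
  have hs := D.summable_shift y
  have h1 : D.slope y - D.partialSlope i y = ∑' j, D.shift (j + i) y := by
    rw [slope, partialSlope, ← hs.sum_add_tsum_nat_add i]
    ring
  have h2 : HasSum (fun j : ℕ => (1 / 2 : ℝ) ^ j * ((1 / 2) ^ (i + 1) * b))
      (2 * ((1 / 2) ^ (i + 1) * b)) := hasSum_geometric_two.mul_right _
  rw [h1, ← Real.norm_eq_abs]
  refine (tsum_of_norm_bounded h2 fun j => ?_).trans (le_of_eq (by ring))
  refine (D.abs_shift_le _ y).trans ((hb _ (by omega)).trans (le_of_eq ?_))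
  ring

theorem abs_partialSlope_le (i : ℕ) (y : ℝ) : |D.partialSlope i y| ≤ 1 - (1 / 2) ^ i := by
  induction i with
  | zero => simp [partialSlope]
  | succ i ih =>
    rw [partialSlope, Finset.sum_range_succ, ← partialSlope]
    refine (abs_add_le _ _).trans ?_
    have h1 := (D.abs_shift_le i y).trans (D.step_le_half i)
    have h2 : (1 / 2 : ℝ) ^ i = 2 * (1 / 2) ^ (i + 1) := by ring
    linarith

theorem abs_slope_le (y : ℝ) : |D.slope y| ≤ 1 := by
  have := D.abs_slope_sub_le (b := 1) (i := 0) (fun j _ => by simpa using D.step_le_half j) y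
  simpa [partialSlope] using this

theorem exists_partialSlope_eq (i : ℕ) (y : ℝ) : ∃ l : ℤ, D.partialSlope i y = l / D.A i := by
  have key : ∀ j ∈ Finset.range i, ∃ l : ℤ, D.shift j y = l / D.A i := by
    intro j hj
    obtain ⟨k, hk⟩ := D.A_dvd (Finset.mem_range.1 hj)
    have hA := D.A_cast_pos (j + 1)
    have hA' := D.A_cast_pos i
    refine ⟨⌊D.A (j + 1) * (-(D.ρ j * Int.fract (y / D.ρ j) / D.μ j))⌋ * k, ?_⟩
    rw [shift, div_eq_div_iff hA.ne' hA'.ne']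
    rw [Nat.succ_eq_add_one] at hk
    rw [hk]
    push_cast
    ring
  choose! l hl using key
  refine ⟨∑ j ∈ Finset.range i, l j, ?_⟩
  rw [partialSlope, Finset.sum_congr rfl hl, ← Finset.sum_div]
  push_cast
  rfl

/-- The line of slope `slope y` through a point of height `y` over `c ∈ C` has, over a point
`c' ∈ C` with `c' - c` close to `μ i`, a height close to `ρ i * ℤ`. -/
theorem exists_abs_sub_lt {c c' : ℝ} (hc : c ∈ C) (hc' : c' ∈ C) {i : ℕ}
    (h : |c' - c - D.μ i| ≤ D.ε i * |D.μ i|) (y : ℝ) :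
    ∃ k : ℤ, |y + (c' - c) * D.slope y - k * D.ρ i| < 8 * D.ε i * D.ρ i := by
  have hA := D.A_cast_pos i
  have hS := D.S_cast_pos i
  have hε := D.ε_pos i
  have hε1 := D.ε_le i
  have hρ := D.ρ_pos i
  have hμ := D.μ_pos i
  have hμ1 := D.μ_le i
  obtain ⟨l, hl⟩ := D.exists_partialSlope_eq i y
  obtain ⟨k, hk⟩ := D.approx i c hc
  obtain ⟨k', hk'⟩ := D.approx i c' hc'
  have hp := D.abs_partialSlope_le i y
  have hp1 : |D.partialSlope i y| ≤ 1 := hp.trans (by simp)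
  have hδ : D.ε i / (4 * D.A i * D.S i) = D.ε i * D.ρ i / 4 := by
    rw [ρ]; field_simp
  rw [hδ] at hk hk'
  set a := D.partialSlope i y with ha
  -- Earlier corrections: `a` is a multiple of `1 / A i` and `c' - c` nearly one of `1 / S i`, so
  -- the product is nearly a multiple of `ρ i`.
  have e1 : |(c' - c) * a - (k' - k) * l * D.ρ i| ≤ D.ε i * D.ρ i / 2 := by
    have : (c' - c) * a - (k' - k) * l * D.ρ i = ((c' - k' / D.S i) - (c - k / D.S i)) * a := by
      rw [hl, ρ]; field_simp; ring
    rw [this, abs_mul]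
    calc _ ≤ (D.ε i * D.ρ i / 4 + D.ε i * D.ρ i / 4) * 1 := by
          gcongr
          exact (abs_sub _ _).trans (add_le_add hk' hk)
      _ = _ := by ring
  -- The `i`-th correction cancels the fractional part of `y / ρ i`, up to rounding to a multiple of
  -- `1 / A (i + 1)`.
  have e2 : |y + D.μ i * D.shift i y - ⌊y / D.ρ i⌋ * D.ρ i| ≤ D.ε i * D.ρ i := by
    have : y + D.μ i * D.shift i y - ⌊y / D.ρ i⌋ * D.ρ i
        = D.μ i * (D.shift i y - -(D.ρ i * Int.fract (y / D.ρ i) / D.μ i)) := by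
      have := D.μ_ne i
      rw [Int.fract]
      field_simp
      ring
    rw [this, abs_mul]
    calc _ ≤ 1 * (1 / (D.A (i + 1) : ℝ)) := by
          gcongr
          exact D.abs_shift_sub_le i y
      _ ≤ D.ε i * D.ρ i := by rw [one_mul]; exact D.one_div_A_succ_le i
  -- The cost of replacing `c' - c` by `μ i`: the relative error `ε i` cancels the `1 / |μ i|` in
  -- the size of the correction.
  have e3 : |(c' - c - D.μ i) * D.shift i y| ≤ 2 * (D.ε i * D.ρ i) := by
    rw [abs_mul]
    calc _ ≤ D.ε i * |D.μ i| * D.step i := by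
          gcongr
          exact D.abs_shift_le i y
      _ = _ := by rw [step]; field_simp
  -- Later corrections add up to at most `1 / A (i + 1)`. The four errors total `11/2`, which is
  -- below `8`.
  have e4 : |(c' - c) * (D.slope y - D.partialSlope (i + 1) y)| ≤ 2 * (D.ε i * D.ρ i) := by
    rw [abs_mul]
    have h1 : |c' - c| ≤ 2 := by
      have := abs_add_le (c' - c - D.μ i) (D.μ i)
      rw [sub_add_cancel] at this
      nlinarith
    have h2 := D.abs_slope_sub_le (fun j hj => D.step_le_A (i := i + 1) hj) y
    have h3 : (1 / 2 : ℝ) ^ (i + 1) ≤ 1 := pow_le_one₀ (by norm_num) (by norm_num)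
    calc _ ≤ 2 * (1 * (1 / (D.A (i + 1) : ℝ))) := by
          gcongr
          exact h2.trans (by gcongr)
      _ ≤ 2 * (D.ε i * D.ρ i) := by rw [one_mul]; gcongr; exact D.one_div_A_succ_le i
  refine ⟨(k' - k) * l + ⌊y / D.ρ i⌋, ?_⟩
  have hsplit : D.partialSlope (i + 1) y = a + D.shift i y := by
    rw [partialSlope, Finset.sum_range_succ, ← partialSlope]
  have : y + (c' - c) * D.slope y - ((((k' - k) * l + ⌊y / D.ρ i⌋ : ℤ)) : ℝ) * D.ρ i
      = ((c' - c) * a - (k' - k) * l * D.ρ i)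
        + (y + D.μ i * D.shift i y - ⌊y / D.ρ i⌋ * D.ρ i)
        + ((c' - c - D.μ i) * D.shift i y)
        + ((c' - c) * (D.slope y - D.partialSlope (i + 1) y)) := by
    rw [hsplit]
    push_cast
    ring
  rw [this]
  have t1 := abs_add_le (((c' - c) * a - (k' - k) * l * D.ρ i)
        + (y + D.μ i * D.shift i y - ⌊y / D.ρ i⌋ * D.ρ i)
        + ((c' - c - D.μ i) * D.shift i y)) ((c' - c) * (D.slope y - D.partialSlope (i + 1) y))
  have t2 := abs_add_le (((c' - c) * a - (k' - k) * l * D.ρ i)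
        + (y + D.μ i * D.shift i y - ⌊y / D.ρ i⌋ * D.ρ i))
        ((c' - c - D.μ i) * D.shift i y)
  have t3 := abs_add_le ((c' - c) * a - (k' - k) * l * D.ρ i)
        (y + D.μ i * D.shift i y - ⌊y / D.ρ i⌋ * D.ρ i)
  have : 0 < D.ε i * D.ρ i := by positivity
  linarith

/-- The `i`-th correction has denominator `A (i + 1)` and numerator at most `A (i + 1) * ρ i / |μ i|
= q i / |μ i|` before rounding. `S i` has dropped out, which is what allows it to be chosen after `v
i`. -/
theorem exists_finset_partialSlope (i : ℕ) :
    ∃ V : Finset ℝ, (V.card : ℝ) ≤ D.count i ∧ ∀ y, D.partialSlope i y ∈ V := by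
  induction i with
  | zero => exact ⟨{0}, by simp [count], fun y => by simp [partialSlope]⟩
  | succ i ih =>
    obtain ⟨V, hV, hmem⟩ := ih
    refine ⟨Finset.image₂ (fun x (k : ℤ) => x + k / D.A (i + 1)) V
      (Finset.Icc (-(D.v i : ℤ)) (D.v i)), ?_, fun y => ?_⟩
    · have h1 := Finset.card_image₂_le (fun x (k : ℤ) => x + k / (D.A (i + 1) : ℝ)) V
        (Finset.Icc (-(D.v i : ℤ)) (D.v i))
      have h2 : (Finset.Icc (-(D.v i : ℤ)) (D.v i)).card = 2 * D.v i + 1 := by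
        rw [Int.card_Icc]; omega
      rw [h2] at h1
      calc ((Finset.image₂ (fun x (k : ℤ) => x + k / (D.A (i + 1) : ℝ)) V
            (Finset.Icc (-(D.v i : ℤ)) (D.v i))).card : ℝ)
          ≤ V.card * (2 * D.v i + 1) := by exact_mod_cast h1
        _ ≤ D.count i * (2 * D.v i + 1) := by gcongr
        _ = D.count (i + 1) := by rw [count, count, Finset.prod_range_succ]
    · rw [partialSlope, Finset.sum_range_succ, ← partialSlope]
      refine Finset.mem_image₂_of_mem (hmem y) ?_
      have hA := D.A_cast_pos (i + 1)
      have h1 : |D.A (i + 1) * (-(D.ρ i * Int.fract (y / D.ρ i) / D.μ i))| ≤ D.q i / |D.μ i| := by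
        rw [abs_mul, abs_of_pos hA]
        refine (mul_le_mul_of_nonneg_left (D.abs_raw_le i y) hA.le).trans (le_of_eq ?_)
        have h2 := D.one_div_A_succ i
        rw [div_eq_div_iff hA.ne' (D.q_pos i).ne', one_mul] at h2
        rw [h2]
        ring
      have h2 := abs_le.1 h1
      have h3 := D.le_v i
      rw [Finset.mem_Icc]
      constructor
      · rw [Int.le_floor]
        push_cast
        linarith
      · have h4 : ((D.A (i + 1) : ℝ) * (-(D.ρ i * Int.fract (y / D.ρ i) / D.μ i))) <
            ((D.v i : ℤ) : ℝ) := by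
          push_cast
          linarith
        exact (Int.floor_lt.2 h4).le

theorem measurable_shift (i : ℕ) : Measurable (D.shift i) := by
  unfold shift
  fun_prop

theorem measurable_slope : Measurable D.slope := by
  refine measurable_of_tendsto_metrizable (f := fun n y => D.partialSlope n y) ?_ ?_
  · intro n
    exact Finset.measurable_fun_sum _ fun j _ => D.measurable_shift j
  · rw [tendsto_pi_nhds]
    intro y
    exact (D.summable_shift y).hasSum.tendsto_sum_nat

/-! ### Distribution of the slopes after projection. -/

/-- Where the partial slope has a given value, `y - κ * slope y` is a translation of `y` up to an
error `3 * H`. Each such piece of the preimage thus has diameter at most that of `s` plus `6 * H`,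
and there are at most `count i` pieces. -/
theorem volume_preimage_le {κ : ℝ} (hκ : |κ| ≤ 3) (i : ℕ) (s : Set ℝ) :
    volume {y | y - κ * D.slope y ∈ s} ≤ ENNReal.ofReal (D.count i) *
      (Metric.ediam s + ENNReal.ofReal (6 * ((1 / 2) ^ i * (1 / D.count (i + 1) ^ M)))) := by
  obtain ⟨V, hV, hmem⟩ := D.exists_finset_partialSlope i
  set H : ℝ := (1 / 2) ^ i * (1 / D.count (i + 1) ^ M) with hH
  have hcover : {y | y - κ * D.slope y ∈ s} ⊆
      ⋃ v ∈ V, {y | D.partialSlope i y = v ∧ y - κ * D.slope y ∈ s} := by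
    intro y hy
    simp only [mem_iUnion]
    exact ⟨_, hmem y, rfl, hy⟩
  have hdiam : ∀ v ∈ V, volume {y | D.partialSlope i y = v ∧ y - κ * D.slope y ∈ s} ≤
      Metric.ediam s + ENNReal.ofReal (6 * H) := by
    intro v _
    refine (Real.volume_le_diam _).trans (Metric.ediam_le ?_)
    rintro y ⟨hy, hys⟩ z ⟨hz, hzs⟩
    have h1 := D.abs_slope_sub_le (fun j hj => D.step_le_count (i := i) hj) y
    have h2 := D.abs_slope_sub_le (fun j hj => D.step_le_count (i := i) hj) z
    rw [hy] at h1
    rw [hz] at h2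
    refine le_trans ?_ (add_le_add_left (Metric.edist_le_ediam_of_mem hys hzs) _)
    rw [edist_dist, edist_dist, ← ENNReal.ofReal_add dist_nonneg
      (by have := D.count_pos (i + 1); positivity)]
    refine ENNReal.ofReal_le_ofReal ?_
    rw [Real.dist_eq, Real.dist_eq]
    have h3 : y - z = (y - κ * D.slope y - (z - κ * D.slope z))
        + κ * ((D.slope y - v) - (D.slope z - v)) := by ring
    have h4 := abs_add_le (y - κ * D.slope y - (z - κ * D.slope z))
      (κ * ((D.slope y - v) - (D.slope z - v)))
    rw [← h3, abs_mul] at h4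
    have h5 := abs_sub (D.slope y - v) (D.slope z - v)
    have h6 : |κ| * |(D.slope y - v) - (D.slope z - v)| ≤ 3 * (H + H) := by
      gcongr
      linarith
    linarith
  calc volume {y | y - κ * D.slope y ∈ s}
      ≤ ∑ v ∈ V, volume {y | D.partialSlope i y = v ∧ y - κ * D.slope y ∈ s} :=
        (measure_mono hcover).trans (measure_biUnion_finset_le _ _)
    _ ≤ ∑ v ∈ V, (Metric.ediam s + ENNReal.ofReal (6 * H)) := Finset.sum_le_sum hdiam
    _ = V.card * (Metric.ediam s + ENNReal.ofReal (6 * H)) := by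
        rw [Finset.sum_const, nsmul_eq_mul]
    _ ≤ _ := by
        gcongr
        rw [← ENNReal.ofReal_natCast]
        exact ENNReal.ofReal_le_ofReal hV

theorem volume_preimage_le_rpow (hM : 0 < M) {κ : ℝ} (hκ : |κ| ≤ 3) {s : Set ℝ} {r : ℝ}
    (hr : 0 < r) (hr1 : r ≤ 1) (hs : Metric.ediam s ≤ ENNReal.ofReal r) :
    volume {y | y - κ * D.slope y ∈ s} ≤ 7 * ENNReal.ofReal r ^ (1 - 1 / (M : ℝ)) := by
  let H : ℕ → ℝ := fun i => (1 / 2) ^ i * (1 / D.count (i + 1) ^ M)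
  have hHle : ∀ i, H i ≤ (1 / 2) ^ i := fun i => by
    refine mul_le_of_le_one_right (by positivity) ?_
    rw [div_le_one (by have := D.count_pos (i + 1); positivity)]
    exact one_le_pow₀ (D.one_le_count _)
  have hex : ∃ i, H i ≤ r := by
    obtain ⟨i, hi⟩ := exists_pow_lt_of_lt_one hr (by norm_num : (1 / 2 : ℝ) < 1)
    exact ⟨i, (hHle i).trans hi.le⟩
  classical
  obtain ⟨i, hi, hmin⟩ : ∃ i, H i ≤ r ∧ ∀ j < i, r < H j :=
    ⟨Nat.find hex, Nat.find_spec hex, fun j hj => not_le.1 (Nat.find_min hex hj)⟩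
  -- Minimality at `i - 1` gives `r < H (i - 1) ≤ 1 / count i ^ M`; the shifted index in `H` is
  -- needed here.
  have hcr : D.count i ^ M ≤ r⁻¹ := by
    rcases Nat.eq_zero_or_pos i with h0 | h0
    · subst h0
      simpa [count] using (one_le_inv₀ hr).2 hr1
    · obtain ⟨j, rfl⟩ := Nat.exists_eq_succ_of_ne_zero h0.ne'
      have h1 := (hmin j (Nat.lt_succ_self j)).le
      have hc := D.count_pos (j + 1)
      have h2 : r ≤ 1 / D.count (j + 1) ^ M := by
        refine h1.trans (mul_le_of_le_one_left (by positivity) ?_)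
        exact pow_le_one₀ (by norm_num) (by norm_num)
      rw [le_inv_comm₀ (by positivity) hr]
      simpa using h2
  have hcount : D.count i * r ≤ r ^ (1 - 1 / (M : ℝ)) := by
    have hM' : (M : ℝ) ≠ 0 := by positivity
    have h1 : D.count i ≤ r⁻¹ ^ (1 / (M : ℝ)) := by
      have := Real.rpow_le_rpow (by have := D.count_pos i; positivity) hcr
        (by positivity : (0 : ℝ) ≤ 1 / M)
      rwa [← Real.rpow_natCast, ← Real.rpow_mul (D.count_pos i).le, mul_one_div_cancel hM',
        Real.rpow_one] at this
    calc D.count i * r ≤ r⁻¹ ^ (1 / (M : ℝ)) * r := by gcongr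
      _ = r ^ (1 - 1 / (M : ℝ)) := by
        rw [Real.inv_rpow hr.le, sub_eq_add_neg, Real.rpow_add hr, Real.rpow_one,
          Real.rpow_neg hr.le, mul_comm]
  calc volume {y | y - κ * D.slope y ∈ s}
      ≤ ENNReal.ofReal (D.count i) * (ENNReal.ofReal r + ENNReal.ofReal (6 * r)) := by
        refine (D.volume_preimage_le hκ i s).trans ?_
        gcongr
    _ = ENNReal.ofReal (7 * (D.count i * r)) := by
        rw [← ENNReal.ofReal_add hr.le (by positivity), ← ENNReal.ofReal_mul (D.count_pos i).le]
        congr 1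
        ring
    _ ≤ ENNReal.ofReal (7 * r ^ (1 - 1 / (M : ℝ))) := by gcongr
    _ = 7 * ENNReal.ofReal r ^ (1 - 1 / (M : ℝ)) := by
        rw [ENNReal.ofReal_mul (by norm_num), ENNReal.ofReal_rpow_of_pos hr]
        simp

theorem volume_preimage_eq_zero (hM : 1 < M) {κ : ℝ} (hκ : |κ| ≤ 3) {E : Set ℝ}
    (hE : μH[1 - 1 / (M : ℝ)] E = 0) : volume {y | y - κ * D.slope y ∈ E} = 0 := by
  have hmeas : Measurable fun y => y - κ * D.slope y :=
    measurable_id.sub (D.measurable_slope.const_mul κ)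
  have hM' : (1 : ℝ) < M := by exact_mod_cast hM
  have hac : volume.map (fun y => y - κ * D.slope y) ≪ (μH[1 - 1 / (M : ℝ)] : Measure ℝ) := by
    refine absolutelyContinuous_hausdorffMeasure_of_ediam ?_ _ 7 one_pos ?_
    · rw [sub_pos, div_lt_one (by linarith)]
      exact hM'
    · intro s r hs hr hr1 hd
      rw [Measure.map_apply hmeas hs.measurableSet]
      exact D.volume_preimage_le_rpow (by omega) hκ hr hr1 hd
  exact Measure.preimage_null_of_map_null hmeas.aemeasurable (hac hE)

end ScaleData

/-! ### The Cantor set. -/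

/-- Parameters of a homogeneous Cantor set of dimension `τ` whose numbers of children
`2 ^ r n` grow. -/
structure CantorParams (τ : ℝ) where
  r : ℕ → ℕ
  τ_pos : 0 < τ
  τ_lt : τ < 1
  small : ∀ n, (1 + r n : ℝ) * (2 : ℝ) ^ (-((1 / τ - 1) * r n)) ≤ (1 / 2) ^ n / 1024

theorem CantorParams.nonempty {τ : ℝ} (h0 : 0 < τ) (h1 : τ < 1) : Nonempty (CantorParams τ) := by
  have hδ : 0 < 1 / τ - 1 := by
    rw [sub_pos, lt_div_iff₀ h0]
    linarith
  set b : ℝ := (2 : ℝ) ^ (-(1 / τ - 1)) with hb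
  have hb0 : 0 ≤ b := by positivity
  have hb1 : b < 1 := Real.rpow_lt_one_of_one_lt_of_neg (by norm_num) (by linarith)
  have hlim : Filter.Tendsto (fun k : ℕ => (1 + k : ℝ) * b ^ k) Filter.atTop (nhds 0) := by
    have h2 := tendsto_pow_atTop_nhds_zero_of_lt_one hb0 hb1
    have h3 := tendsto_self_mul_const_pow_of_lt_one hb0 hb1
    have h4 := h2.add h3
    rw [add_zero] at h4
    refine h4.congr fun k => ?_
    ring
  have hex : ∀ n : ℕ, ∃ k : ℕ, (1 + k : ℝ) * b ^ k ≤ (1 / 2) ^ n / 1024 := fun n =>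
    (hlim.eventually (Iic_mem_nhds (by positivity : (0 : ℝ) < (1 / 2) ^ n / 1024))).exists
  choose r hr using hex
  refine ⟨⟨r, h0, h1, fun n => ?_⟩⟩
  have h5 := hr n
  rwa [hb, ← Real.rpow_natCast, ← Real.rpow_mul (by norm_num), neg_mul] at h5

namespace CantorParams

variable {τ : ℝ} (P : CantorParams τ)

/-- The level `n` intervals are `2 ^ (P.a n)` in number. -/
def a (n : ℕ) : ℕ := ∑ j ∈ Finset.range n, P.r j

/-- Chosen so that `2 ^ a n * width n ^ τ` is at most `1` and, up to rounding, equal to it. -/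
noncomputable def e (n : ℕ) : ℕ := ⌈(P.a n : ℝ) / τ⌉₊

/-- The level `n` intervals have length comparable to `P.width n`. -/
noncomputable def width (n : ℕ) : ℝ := (1 / 2) ^ P.e n

/-- The spacing of the level `n + 1` intervals inside a level `n` interval. -/
noncomputable def spacing (n : ℕ) : ℝ := (1 / 2) ^ (P.r n + P.e n)

/-- An upper bound for `width (n + 1) / spacing n`; the factor `2` absorbs the rounding in `e`. -/
noncomputable def gap (n : ℕ) : ℝ := 2 * (2 : ℝ) ^ (-((1 / τ - 1) * P.r n))

abbrev Digits : Type := ∀ n, Fin (2 ^ P.r n)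

noncomputable def point (k : P.Digits) : ℝ := ∑' n, (k n : ℝ) * P.spacing n

noncomputable def tail (n : ℕ) (k : P.Digits) : ℝ := ∑' j, (k (j + n) : ℝ) * P.spacing (j + n)

theorem width_pos (n : ℕ) : 0 < P.width n := by unfold width; positivity

theorem spacing_pos (n : ℕ) : 0 < P.spacing n := by unfold spacing; positivity

theorem gap_pos (n : ℕ) : 0 < P.gap n := by unfold gap; positivity

theorem gap_mul_le (n : ℕ) : (1 + P.r n) * P.gap n ≤ (1 / 2) ^ n / 512 := by
  have := P.small n
  rw [gap]
  linarith

theorem gap_le (n : ℕ) : P.gap n ≤ (1 / 2) ^ n / 512 := by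
  have h1 := P.gap_mul_le n
  have h2 := P.gap_pos n
  have h3 : (0 : ℝ) ≤ P.r n := Nat.cast_nonneg _
  nlinarith

theorem gap_le_quarter (n : ℕ) : P.gap n ≤ 1 / 4 := by
  have h1 := P.gap_le n
  have h2 : (1 / 2 : ℝ) ^ n ≤ 1 := pow_le_one₀ (by norm_num) (by norm_num)
  linarith

theorem one_le_r (n : ℕ) : 1 ≤ P.r n := by
  by_contra h
  have h0 : P.r n = 0 := by omega
  have h1 := P.gap_le_quarter n
  rw [gap, h0] at h1
  norm_num at h1

theorem a_succ (n : ℕ) : P.a (n + 1) = P.a n + P.r n := Finset.sum_range_succ _ _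

theorem le_a (n : ℕ) : n ≤ P.a n := by
  induction n with
  | zero => exact Nat.zero_le _
  | succ n ih =>
    have := P.one_le_r n
    rw [a_succ]
    omega

theorem a_le_mul_e (n : ℕ) : (P.a n : ℝ) ≤ τ * P.e n := by
  have := Nat.le_ceil ((P.a n : ℝ) / τ)
  rwa [div_le_iff₀ P.τ_pos, mul_comm] at this

theorem mul_e_le (n : ℕ) : τ * P.e n ≤ P.a n + τ := by
  have h := Nat.ceil_lt_add_one (a := (P.a n : ℝ) / τ) (by have := P.τ_pos; positivity)
  have h1 : τ * P.e n ≤ τ * ((P.a n : ℝ) / τ + 1) := mul_le_mul_of_nonneg_left h.le P.τ_pos.le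
  have h2 : τ * ((P.a n : ℝ) / τ + 1) = P.a n + τ := by
    have := P.τ_pos.ne'
    field_simp
  linarith

theorem a_le_e (n : ℕ) : P.a n ≤ P.e n := by
  have h1 := P.a_le_mul_e n
  have h2 := P.τ_lt
  have h3 : (0 : ℝ) ≤ P.e n := Nat.cast_nonneg _
  have : (P.a n : ℝ) ≤ P.e n := by nlinarith
  exact_mod_cast this

theorem e_zero : P.e 0 = 0 := by simp [e, a]

theorem width_zero : P.width 0 = 1 := by rw [width, e_zero, pow_zero]

theorem half_pow_eq (n : ℕ) : (1 / 2 : ℝ) ^ n = (2 : ℝ) ^ (-(n : ℝ)) := by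
  rw [Real.rpow_neg (by norm_num), Real.rpow_natCast, one_div, inv_pow]

theorem width_succ_le (n : ℕ) : P.width (n + 1) ≤ P.gap n * P.spacing n := by
  have hτ := P.τ_pos
  have h1 := P.a_le_mul_e (n + 1)
  have h2 := P.mul_e_le n
  rw [a_succ] at h1
  push_cast at h1
  have h3 : (P.r n : ℝ) / τ + P.e n - 1 ≤ P.e (n + 1) := by
    rw [← mul_le_mul_iff_right₀ hτ]
    have : τ * ((P.r n : ℝ) / τ + P.e n - 1) = P.r n + τ * P.e n - τ := by field_simp
    linarith
  rw [width, gap, spacing, half_pow_eq, half_pow_eq]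
  have : (2 : ℝ) * (2 : ℝ) ^ (-((1 / τ - 1) * P.r n)) * (2 : ℝ) ^ (-((P.r n + P.e n : ℕ) : ℝ))
      = (2 : ℝ) ^ (1 + -((1 / τ - 1) * P.r n) + -((P.r n + P.e n : ℕ) : ℝ)) := by
    rw [Real.rpow_add (by norm_num), Real.rpow_add (by norm_num), Real.rpow_one]
  rw [this]
  refine Real.rpow_le_rpow_of_exponent_le (by norm_num) ?_
  push_cast
  have h4 : (1 / τ - 1) * (P.r n : ℝ) = P.r n / τ - P.r n := by ring
  linarith

theorem two_pow_mul_spacing (n : ℕ) : (2 : ℝ) ^ P.r n * P.spacing n = P.width n := by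
  rw [spacing, width, pow_add, ← mul_assoc, ← mul_pow]
  norm_num

theorem spacing_le_width (n : ℕ) : P.spacing n ≤ P.width n := by
  rw [← two_pow_mul_spacing]
  exact le_mul_of_one_le_left (P.spacing_pos n).le (one_le_pow₀ (by norm_num))

theorem width_succ_le_half (n : ℕ) : P.width (n + 1) ≤ 1 / 2 * P.width n := by
  have h1 := P.width_succ_le n
  have h2 := P.gap_le_quarter n
  have h3 := P.spacing_le_width n
  have h4 := P.spacing_pos n
  nlinarith

theorem width_add_le (n j : ℕ) : P.width (j + n) ≤ (1 / 2) ^ j * P.width n := by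
  induction j with
  | zero => simp
  | succ j ih =>
    have h := P.width_succ_le_half (j + n)
    rw [show j + 1 + n = j + n + 1 by ring, pow_succ']
    linarith

theorem exponent_le (n : ℕ) : P.r n + P.e n ≤ P.e (n + 1) := by
  have h1 := P.width_succ_le n
  have h2 := P.gap_le_quarter n
  have h3 := P.spacing_pos n
  have h4 : P.width (n + 1) ≤ P.spacing n := by nlinarith
  rwa [width, spacing, pow_le_pow_iff_right_of_lt_one₀ (by norm_num) (by norm_num)] at h4

theorem exponent_mono {i j : ℕ} (h : i ≤ j) : P.r i + P.e i ≤ P.r j + P.e j := by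
  induction j, h using Nat.le_induction with
  | base => exact le_rfl
  | succ j _ ih =>
    have := P.exponent_le j
    omega

theorem term_nonneg (k : P.Digits) (n : ℕ) : 0 ≤ (k n : ℝ) * P.spacing n :=
  mul_nonneg (Nat.cast_nonneg _) (P.spacing_pos n).le

theorem term_le (k : P.Digits) (n : ℕ) : (k n : ℝ) * P.spacing n ≤ P.width n := by
  rw [← two_pow_mul_spacing]
  have := P.spacing_pos n
  gcongr
  exact_mod_cast (k n).2.le

theorem summable_width : Summable P.width := by
  refine Summable.of_nonneg_of_le (fun n => (P.width_pos n).le) (fun n => ?_)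
    (summable_geometric_of_lt_one (by norm_num) (by norm_num : (1 / 2 : ℝ) < 1))
  simpa [width_zero] using P.width_add_le 0 n

theorem summable_term (k : P.Digits) : Summable fun n => (k n : ℝ) * P.spacing n :=
  Summable.of_nonneg_of_le (P.term_nonneg k) (P.term_le k) P.summable_width

theorem tail_nonneg (n : ℕ) (k : P.Digits) : 0 ≤ P.tail n k :=
  tsum_nonneg fun _ => P.term_nonneg k _

theorem tail_le (n : ℕ) (k : P.Digits) : P.tail n k ≤ 2 * P.width n := by
  have h : HasSum (fun j : ℕ => (1 / 2 : ℝ) ^ j * P.width n) (2 * P.width n) :=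
    hasSum_geometric_two.mul_right _
  have h2 := tsum_of_norm_bounded (f := fun j => (k (j + n) : ℝ) * P.spacing (j + n)) h fun j => by
    rw [Real.norm_of_nonneg (P.term_nonneg k _)]
    exact (P.term_le k _).trans (P.width_add_le n j)
  exact (le_abs_self _).trans h2

theorem point_eq (n : ℕ) (k : P.Digits) :
    P.point k = ∑ j ∈ Finset.range n, (k j : ℝ) * P.spacing j + P.tail n k :=
  ((P.summable_term k).sum_add_tsum_nat_add n).symm

theorem point_mem_Icc (k : P.Digits) : P.point k ∈ Icc (0 : ℝ) 2 := by
  have h1 := P.point_eq 0 k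
  have h2 := P.tail_nonneg 0 k
  have h3 := P.tail_le 0 k
  rw [width_zero] at h3
  rw [Finset.range_zero, Finset.sum_empty, zero_add] at h1
  rw [h1]
  exact ⟨h2, by linarith⟩

/-- The common digits cancel, leaving the difference of two tails in `[0, 2 * width (n + 1)]`. -/
theorem abs_point_sub_le {k k' : P.Digits} {n : ℕ} (h : ∀ j < n, k j = k' j) :
    |P.point k' - P.point k - (((k' n : ℕ) : ℤ) - ((k n : ℕ) : ℤ) : ℤ) * P.spacing n|
      ≤ 2 * P.gap n * P.spacing n := by
  have h1 : P.point k' - P.point k - (((k' n : ℕ) : ℤ) - ((k n : ℕ) : ℤ) : ℤ) * P.spacing n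
      = P.tail (n + 1) k' - P.tail (n + 1) k := by
    have h0 : ∑ j ∈ Finset.range n, (k j : ℝ) * P.spacing j
        = ∑ j ∈ Finset.range n, (k' j : ℝ) * P.spacing j :=
      Finset.sum_congr rfl fun j hj => by rw [h j (Finset.mem_range.1 hj)]
    rw [P.point_eq (n + 1) k, P.point_eq (n + 1) k', Finset.sum_range_succ, Finset.sum_range_succ,
      h0]
    push_cast
    ring
  have h2 := P.tail_nonneg (n + 1) k
  have h3 := P.tail_nonneg (n + 1) k'
  have h4 := P.tail_le (n + 1) k
  have h5 := P.tail_le (n + 1) k'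
  have h6 := P.width_succ_le n
  rw [h1, abs_le]
  constructor <;> linarith

theorem exists_first_diff {k k' : P.Digits} (h : k ≠ k') :
    ∃ n, (∀ j < n, k j = k' j) ∧ k n ≠ k' n := by
  classical
  have hex : ∃ n, k n ≠ k' n := Function.ne_iff.1 h
  exact ⟨Nat.find hex, fun j hj => not_not.1 (Nat.find_min hex hj), Nat.find_spec hex⟩

theorem continuous_point : Continuous P.point := by
  refine continuous_tsum (u := P.width) (fun n => ?_) P.summable_width fun n k => ?_
  · have h1 : Continuous fun x : Fin (2 ^ P.r n) => (x : ℝ) := continuous_of_discreteTopology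
    exact (h1.comp (continuous_apply n)).mul_const _
  · rw [Real.norm_of_nonneg (P.term_nonneg k n)]
    exact P.term_le k n

/-- Take `S = 1 / spacing p`: every earlier spacing is a multiple of `spacing p`, and the tail
beyond level `p` is at most `2 * gap p * spacing p`, where `gap p → 0`. -/
theorem exists_approx {δ : ℝ} (hδ : 0 < δ) (B : ℝ) :
    ∃ S : ℕ, B ≤ S ∧ ∀ c ∈ range P.point, ∃ k : ℤ, |c - k / S| ≤ δ / S := by
  obtain ⟨p₁, hp₁⟩ := exists_pow_lt_of_lt_one hδ (by norm_num : (1 / 2 : ℝ) < 1)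
  obtain ⟨p₂, hp₂⟩ := pow_unbounded_of_one_lt B (by norm_num : (1 : ℝ) < 2)
  let p := max p₁ p₂
  have hS : ((2 ^ (P.r p + P.e p) : ℕ) : ℝ) = (2 : ℝ) ^ (P.r p + P.e p) := by push_cast; rfl
  have hsp : P.spacing p = 1 / (2 : ℝ) ^ (P.r p + P.e p) := by rw [spacing, one_div_pow]
  refine ⟨2 ^ (P.r p + P.e p), ?_, ?_⟩
  · rw [hS]
    refine hp₂.le.trans (pow_le_pow_right₀ (by norm_num) ?_)
    have h1 := P.le_a p
    have h2 := P.a_le_e p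
    have h3 : p₂ ≤ p := le_max_right _ _
    omega
  · rintro _ ⟨k, rfl⟩
    rw [hS]
    refine ⟨∑ j ∈ Finset.range (p + 1), (k j : ℤ) * 2 ^ (P.r p + P.e p - (P.r j + P.e j)), ?_⟩
    have h1 : ((∑ j ∈ Finset.range (p + 1),
        ((k j : ℕ) : ℤ) * 2 ^ (P.r p + P.e p - (P.r j + P.e j)) : ℤ) : ℝ) /
          (2 : ℝ) ^ (P.r p + P.e p) = ∑ j ∈ Finset.range (p + 1), (k j : ℝ) * P.spacing j := by
      push_cast
      rw [Finset.sum_div]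
      refine Finset.sum_congr rfl fun j hj => ?_
      have h2 := P.exponent_mono (Nat.lt_succ_iff.1 (Finset.mem_range.1 hj))
      rw [spacing, one_div_pow, mul_div_assoc]
      congr 1
      rw [div_eq_div_iff (by positivity) (by positivity), one_mul, ← pow_add]
      congr 1
      omega
    rw [h1, P.point_eq (p + 1) k, add_sub_cancel_left, abs_of_nonneg (P.tail_nonneg _ _)]
    have h3 := P.tail_le (p + 1) k
    have h4 := P.width_succ_le p
    have h5 := P.gap_le p
    have h6 : (1 / 2 : ℝ) ^ p ≤ (1 / 2) ^ p₁ :=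
      pow_le_pow_of_le_one (by norm_num) (by norm_num) (le_max_left _ _)
    have h7 := P.spacing_pos p
    have h8 : 2 * P.gap p ≤ δ := by
      have : (0 : ℝ) < (1 / 2) ^ p := by positivity
      linarith
    calc P.tail (p + 1) k ≤ 2 * P.gap p * P.spacing p := by linarith
      _ ≤ δ * P.spacing p := by gcongr
      _ = δ / (2 : ℝ) ^ (P.r p + P.e p) := by rw [hsp]; ring

theorem exists_cover (n : ℕ) : ∃ V : Finset ℝ, (V.card : ℝ) * P.width n ^ τ ≤ 1 ∧
    range P.point ⊆ ⋃ v ∈ V, Icc v (v + 2 * P.width n) := by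
  have key : ∀ n, ∃ V : Finset ℝ, V.card ≤ 2 ^ P.a n ∧
      ∀ k : P.Digits, ∑ j ∈ Finset.range n, (k j : ℝ) * P.spacing j ∈ V := by
    intro n
    induction n with
    | zero => exact ⟨{0}, by simp [a], fun k => by simp⟩
    | succ n ih =>
      obtain ⟨V, hV, hmem⟩ := ih
      refine ⟨Finset.image₂ (fun x (l : ℕ) => x + l * P.spacing n) V (Finset.range (2 ^ P.r n)),
        ?_, fun k => ?_⟩
      · refine (Finset.card_image₂_le _ _ _).trans ?_
        rw [Finset.card_range, a_succ, pow_add]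
        exact Nat.mul_le_mul_right _ hV
      · rw [Finset.sum_range_succ]
        exact Finset.mem_image₂_of_mem (f := fun x (l : ℕ) => x + l * P.spacing n) (hmem k)
          (Finset.mem_range.2 (k n).2)
  obtain ⟨V, hV, hmem⟩ := key n
  refine ⟨V, ?_, ?_⟩
  · have h1 : (V.card : ℝ) ≤ (2 : ℝ) ^ (P.a n : ℝ) := by
      rw [Real.rpow_natCast]
      exact_mod_cast hV
    have h2 : P.width n ^ τ = (2 : ℝ) ^ (-(τ * P.e n)) := by
      rw [width, half_pow_eq, ← Real.rpow_mul (by norm_num)]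
      congr 1
      ring
    calc (V.card : ℝ) * P.width n ^ τ ≤ (2 : ℝ) ^ (P.a n : ℝ) * (2 : ℝ) ^ (-(τ * P.e n)) := by
          rw [h2]; gcongr
      _ = (2 : ℝ) ^ ((P.a n : ℝ) + -(τ * P.e n)) := (Real.rpow_add (by norm_num) _ _).symm
      _ ≤ 1 := Real.rpow_le_one_of_one_le_of_nonpos (by norm_num)
          (by have := P.a_le_mul_e n; linarith)
  · rintro _ ⟨k, rfl⟩
    have h1 := P.point_eq n k
    have h2 := P.tail_nonneg n k
    have h3 := P.tail_le n k
    simp only [mem_iUnion]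
    exact ⟨_, hmem k, by linarith, by linarith⟩

theorem width_le (n : ℕ) : P.width n ≤ (1 / 2) ^ n := by
  simpa [width_zero] using P.width_add_le 0 n

end CantorParams

/-! ### Differences of the Cantor set. -/

namespace CantorParams

variable {τ : ℝ} (P : CantorParams τ)

/-- The differences of digits at position `n`. -/
noncomputable def digitDiffs (n : ℕ) : Finset ℤ :=
  (Finset.Icc (-(2 ^ P.r n : ℤ)) (2 ^ P.r n)).erase 0

abbrev DiffIndex : Type := Σ n, {m : ℤ // m ∈ P.digitDiffs n}

/-- The error from `abs_point_sub_le`, relative to the leading term `m * spacing n`. -/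
noncomputable def diffError (x : P.DiffIndex) : ℝ := 2 * P.gap x.1 / |(x.2.1 : ℝ)|

noncomputable def diffValue (x : P.DiffIndex) : ℝ := x.2.1 * P.spacing x.1

theorem digitDiffs_ne (x : P.DiffIndex) : x.2.1 ≠ 0 := Finset.ne_of_mem_erase x.2.2

theorem one_le_abs (x : P.DiffIndex) : (1 : ℝ) ≤ |(x.2.1 : ℝ)| := by
  exact_mod_cast Int.one_le_abs (P.digitDiffs_ne x)

theorem diffError_pos (x : P.DiffIndex) : 0 < P.diffError x := by
  have := P.one_le_abs x
  have := P.gap_pos x.1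
  unfold diffError
  positivity

theorem diffError_le (x : P.DiffIndex) : P.diffError x ≤ 1 := by
  have h1 := P.one_le_abs x
  have h2 := P.gap_le_quarter x.1
  rw [diffError, div_le_one (by linarith)]
  linarith

theorem diffValue_ne (x : P.DiffIndex) : P.diffValue x ≠ 0 :=
  mul_ne_zero (by exact_mod_cast P.digitDiffs_ne x) (P.spacing_pos _).ne'

theorem abs_diffValue_le (x : P.DiffIndex) : |P.diffValue x| ≤ 1 := by
  have h1 := Finset.mem_Icc.1 (Finset.mem_of_mem_erase x.2.2)
  have h2 : |(x.2.1 : ℝ)| ≤ 2 ^ P.r x.1 := by exact_mod_cast abs_le.2 h1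
  rw [diffValue, abs_mul, abs_of_pos (P.spacing_pos _)]
  calc _ ≤ (2 : ℝ) ^ P.r x.1 * P.spacing x.1 := by
        have := P.spacing_pos x.1
        gcongr
    _ = P.width x.1 := P.two_pow_mul_spacing _
    _ ≤ 1 := (P.width_le _).trans (pow_le_one₀ (by norm_num) (by norm_num))

theorem exists_diffIndex {c c' : ℝ} (hc : c ∈ range P.point) (hc' : c' ∈ range P.point)
    (h : c ≠ c') : ∃ x : P.DiffIndex,
      |c' - c - P.diffValue x| ≤ P.diffError x * |P.diffValue x| := by
  obtain ⟨k, rfl⟩ := hc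
  obtain ⟨k', rfl⟩ := hc'
  have hk : k ≠ k' := fun h' => h (by rw [h'])
  obtain ⟨n, heq, hne⟩ := P.exists_first_diff hk
  have h1 := (k n).2
  have h2 := (k' n).2
  have hne' : ((k n : ℕ) : ℤ) ≠ (k' n : ℕ) := by
    intro h'
    exact hne (Fin.ext (by exact_mod_cast h'))
  have h3 : (((k n : ℕ) : ℤ)) < 2 ^ P.r n := by exact_mod_cast h1
  have h4 : (((k' n : ℕ) : ℤ)) < 2 ^ P.r n := by exact_mod_cast h2
  have hm : (((k' n : ℕ) : ℤ) - ((k n : ℕ) : ℤ)) ∈ P.digitDiffs n := by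
    rw [digitDiffs, Finset.mem_erase, Finset.mem_Icc]
    refine ⟨by omega, by omega, by omega⟩
  refine ⟨⟨n, _, hm⟩, (P.abs_point_sub_le heq).trans (le_of_eq ?_)⟩
  have h5 := P.one_le_abs ⟨n, _, hm⟩
  rw [diffError, diffValue, abs_mul, abs_of_pos (P.spacing_pos n), ← mul_assoc,
    div_mul_cancel₀ _ (by linarith)]

theorem sum_one_div_abs_le (n : ℕ) :
    ∑ m ∈ P.digitDiffs n, 1 / |(m : ℝ)| ≤ 2 * (1 + P.r n) := by
  have h1 : P.digitDiffs n ⊆ (Finset.range (2 ^ P.r n)).image (fun i => ((i + 1 : ℕ) : ℤ)) ∪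
      (Finset.range (2 ^ P.r n)).image (fun i => -((i + 1 : ℕ) : ℤ)) := by
    intro m hm
    rw [digitDiffs, Finset.mem_erase, Finset.mem_Icc] at hm
    obtain ⟨h0, h1, h2⟩ := hm
    rw [Finset.mem_union, Finset.mem_image, Finset.mem_image]
    have h3 : ((2 ^ P.r n : ℕ) : ℤ) = 2 ^ P.r n := by push_cast; rfl
    rcases lt_or_gt_of_ne h0 with h | h
    · refine Or.inr ⟨m.natAbs - 1, Finset.mem_range.2 (by omega), by omega⟩
    · refine Or.inl ⟨m.natAbs - 1, Finset.mem_range.2 (by omega), by omega⟩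
  have h2 : ∑ i ∈ Finset.range (2 ^ P.r n), 1 / ((i : ℝ) + 1) ≤ 1 + P.r n := by
    have h3 := harmonic_le_one_add_log (2 ^ P.r n)
    rw [harmonic] at h3
    push_cast at h3
    rw [Real.log_pow] at h3
    have h4 : Real.log 2 ≤ 1 := by
      have := Real.log_le_sub_one_of_pos (by norm_num : (0 : ℝ) < 2)
      linarith
    have h5 : (0 : ℝ) ≤ P.r n := Nat.cast_nonneg _
    simp only [one_div]
    nlinarith
  calc ∑ m ∈ P.digitDiffs n, 1 / |(m : ℝ)|
      ≤ ∑ m ∈ (Finset.range (2 ^ P.r n)).image (fun i => ((i + 1 : ℕ) : ℤ)) ∪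
        (Finset.range (2 ^ P.r n)).image (fun i => -((i + 1 : ℕ) : ℤ)), 1 / |(m : ℝ)| :=
        Finset.sum_le_sum_of_subset_of_nonneg h1 fun _ _ _ => by positivity
    _ ≤ ∑ m ∈ (Finset.range (2 ^ P.r n)).image (fun i => ((i + 1 : ℕ) : ℤ)), 1 / |(m : ℝ)| +
        ∑ m ∈ (Finset.range (2 ^ P.r n)).image (fun i => -((i + 1 : ℕ) : ℤ)), 1 / |(m : ℝ)| := by
        rw [← Finset.sum_union_inter]
        exact le_add_of_nonneg_right (Finset.sum_nonneg fun _ _ => by positivity)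
    _ = ∑ i ∈ Finset.range (2 ^ P.r n), 1 / ((i : ℝ) + 1) +
        ∑ i ∈ Finset.range (2 ^ P.r n), 1 / ((i : ℝ) + 1) := by
        have hp : ∀ i : ℕ, |(i : ℝ) + 1| = i + 1 := fun i => abs_of_pos (by positivity)
        rw [Finset.sum_image (by intro i _ j _ h; simpa using h),
          Finset.sum_image (by intro i _ j _ h; simpa using h)]
        congr 1
        · refine Finset.sum_congr rfl fun i _ => ?_
          push_cast
          rw [hp]
        · refine Finset.sum_congr rfl fun i _ => ?_
          push_cast
          rw [abs_neg, hp]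
    _ ≤ 2 * (1 + P.r n) := by linarith

/-- At level `n` the errors form a harmonic sum of size about `gap n * (1 + r n)`. The growth of `r`
imposed by `small` makes this summable over `n`. -/
theorem tsum_diffError_le : ∑' x, ENNReal.ofReal (P.diffError x) ≤ ENNReal.ofReal (1 / 64) := by
  rw [ENNReal.tsum_sigma']
  have h1 : ∀ n, ∑' m : {m : ℤ // m ∈ P.digitDiffs n}, ENNReal.ofReal (P.diffError ⟨n, m⟩)
      ≤ ENNReal.ofReal ((1 / 2) ^ n * (1 / 128)) := by
    intro n
    have h2 : ∀ m : {m : ℤ // m ∈ P.digitDiffs n}, 0 ≤ P.diffError ⟨n, m⟩ :=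
      fun m => (P.diffError_pos _).le
    rw [tsum_fintype, ← ENNReal.ofReal_sum_of_nonneg fun m _ => h2 m]
    refine ENNReal.ofReal_le_ofReal ?_
    have h3 : ∑ m : {m : ℤ // m ∈ P.digitDiffs n}, P.diffError ⟨n, m⟩
        = 2 * P.gap n * ∑ m ∈ P.digitDiffs n, 1 / |(m : ℝ)| := by
      rw [Finset.mul_sum, ← Finset.sum_coe_sort (P.digitDiffs n)]
      refine Finset.sum_congr rfl fun m _ => ?_
      rw [diffError, mul_one_div]
    rw [h3]
    have h4 := P.sum_one_div_abs_le n
    have h5 := P.gap_pos n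
    have h6 := P.gap_mul_le n
    calc 2 * P.gap n * ∑ m ∈ P.digitDiffs n, 1 / |(m : ℝ)|
        ≤ 2 * P.gap n * (2 * (1 + P.r n)) := by gcongr
      _ ≤ _ := by linarith
  refine (ENNReal.tsum_le_tsum h1).trans ?_
  have h2 : HasSum (fun n : ℕ => (1 / 2 : ℝ) ^ n * (1 / 128)) (2 * (1 / 128)) :=
    hasSum_geometric_two.mul_right _
  rw [← ENNReal.ofReal_tsum_of_nonneg (fun n => by positivity) h2.summable, h2.tsum_eq]
  norm_num

instance : Infinite P.DiffIndex := by
  refine Infinite.of_injective (fun n : ℕ => (⟨n, 1, ?_⟩ : P.DiffIndex)) fun i j h => ?_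
  · rw [digitDiffs, Finset.mem_erase, Finset.mem_Icc]
    have : (1 : ℤ) ≤ 2 ^ P.r n := one_le_pow₀ (by norm_num)
    omega
  · exact congrArg Sigma.fst h

theorem exists_scaleData (M : ℕ) : ∃ D : ScaleData (range P.point) M,
    ∑' i, ENNReal.ofReal (D.ε i) ≤ ENNReal.ofReal (1 / 64) ∧
    ∀ c ∈ range P.point, ∀ c' ∈ range P.point, c ≠ c' →
      ∃ i, |c' - c - D.μ i| ≤ D.ε i * |D.μ i| := by
  obtain ⟨hden⟩ := nonempty_denumerable P.DiffIndex
  let f : ℕ ≃ P.DiffIndex := (Denumerable.eqv P.DiffIndex).symm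
  obtain ⟨D, hε, hμ⟩ := ScaleData.exists_of_approx (C := range P.point) M
    (fun i => P.diffError (f i)) (fun i => P.diffValue (f i)) (fun i => P.diffError_pos _)
    (fun i => P.diffError_le _) (fun i => P.diffValue_ne _) (fun i => P.abs_diffValue_le _)
    (fun δ hδ B => P.exists_approx hδ B)
  refine ⟨D, ?_, ?_⟩
  · rw [hε, Equiv.tsum_eq f (fun x => ENNReal.ofReal (P.diffError x))]
    exact P.tsum_diffError_le
  · intro c hc c' hc' h
    obtain ⟨x, hx⟩ := P.exists_diffIndex hc hc' h
    refine ⟨f.symm x, ?_⟩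
    rw [hε, hμ]
    simpa using hx

/-! ### Parametrization of the Cantor set. -/

/-- The digits of a real number, blocked by `P.r`. -/
noncomputable def digits (u : ℝ) : P.Digits := fun n =>
  ⟨⌊(2 : ℝ) ^ P.a (n + 1) * u⌋₊ % 2 ^ P.r n, Nat.mod_lt _ (by positivity)⟩

/-- A parametrization of the Cantor set by the unit interval. -/
noncomputable def param (u : ℝ) : ℝ := P.point (P.digits u)

theorem param_mem (u : ℝ) : P.param u ∈ range P.point := mem_range_self _

theorem measurable_param : Measurable P.param := by
  refine measurable_of_tendsto_metrizable
    (f := fun n u => ∑ j ∈ Finset.range n, (P.digits u j : ℝ) * P.spacing j) ?_ ?_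
  · intro n
    refine Finset.measurable_fun_sum _ fun j _ => Measurable.mul_const ?_ _
    have h1 : Measurable fun u : ℝ => ⌊(2 : ℝ) ^ P.a (j + 1) * u⌋₊ :=
      Nat.measurable_floor.comp (measurable_id.const_mul _)
    exact (measurable_from_top (f := fun k : ℕ => ((k % 2 ^ P.r j : ℕ) : ℝ))).comp h1
  · rw [tendsto_pi_nhds]
    intro u
    exact (P.summable_term (P.digits u)).hasSum.tendsto_sum_nat

theorem floor_succ (n : ℕ) (u : ℝ) : ⌊(2 : ℝ) ^ P.a (n + 1) * u⌋₊
    = 2 ^ P.r n * ⌊(2 : ℝ) ^ P.a n * u⌋₊ + P.digits u n := by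
  have h1 : ⌊(2 : ℝ) ^ P.a n * u⌋₊ = ⌊(2 : ℝ) ^ P.a (n + 1) * u⌋₊ / 2 ^ P.r n := by
    rw [← Nat.floor_div_natCast]
    congr 1
    rw [a_succ, pow_add]
    push_cast
    field_simp
  rw [h1]
  exact (Nat.div_add_mod _ _).symm

theorem floor_eq_of_digits_eq {u v : ℝ} (hu : u ∈ Ico (0 : ℝ) 1) (hv : v ∈ Ico (0 : ℝ) 1) {n : ℕ}
    (h : ∀ j < n, P.digits u j = P.digits v j) :
    ⌊(2 : ℝ) ^ P.a n * u⌋₊ = ⌊(2 : ℝ) ^ P.a n * v⌋₊ := by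
  induction n with
  | zero =>
    have h0 : P.a 0 = 0 := by simp [a]
    rw [h0, pow_zero, one_mul, one_mul, Nat.floor_eq_zero.2 hu.2, Nat.floor_eq_zero.2 hv.2]
  | succ n ih =>
    rw [floor_succ, floor_succ, ih fun j hj => h j (by omega), h n (by omega)]

theorem abs_sub_lt_of_floor {x y : ℝ} (hx : 0 ≤ x) (hy : 0 ≤ y) :
    |x - y| < |(⌊x⌋₊ : ℝ) - ⌊y⌋₊| + 1 := by
  have h1 := Nat.floor_le hx
  have h2 := Nat.floor_le hy
  have h3 := Nat.lt_floor_add_one x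
  have h4 := Nat.lt_floor_add_one y
  have h5 := le_abs_self ((⌊x⌋₊ : ℝ) - ⌊y⌋₊)
  have h6 := neg_abs_le ((⌊x⌋₊ : ℝ) - ⌊y⌋₊)
  rw [abs_lt]
  constructor <;> linarith

theorem digits_injOn : InjOn P.digits (Ico 0 1) := by
  intro u hu v hv h
  by_contra hne
  have hpos : 0 < |u - v| := abs_pos.2 (sub_ne_zero.2 hne)
  obtain ⟨n, hn⟩ := pow_unbounded_of_one_lt (1 / |u - v|) (by norm_num : (1 : ℝ) < 2)
  have h1 := P.floor_eq_of_digits_eq hu hv (n := n) fun j _ => by rw [h]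
  have h2 := abs_sub_lt_of_floor (x := (2 : ℝ) ^ P.a n * u) (y := (2 : ℝ) ^ P.a n * v)
    (mul_nonneg (by positivity) hu.1) (mul_nonneg (by positivity) hv.1)
  rw [h1, sub_self, abs_zero, zero_add, ← mul_sub, abs_mul, abs_of_pos (by positivity)] at h2
  have h3 : (2 : ℝ) ^ n ≤ 2 ^ P.a n := pow_le_pow_right₀ (by norm_num) (P.le_a n)
  rw [div_lt_iff₀ hpos] at hn
  nlinarith

/-- If the digits first differ at `n`, by `m`, then `u` and `v` are within `2 * m / 2 ^ a (n + 1)`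
while their images are at least `m * spacing n / 2` apart. The bound `m ≤ 2 ^ r n` reconciles `m`
with `m ^ τ`. -/
theorem abs_sub_le_param {u v : ℝ} (hu : u ∈ Ico (0 : ℝ) 1) (hv : v ∈ Ico (0 : ℝ) 1) :
    |u - v| ≤ 8 * |P.param u - P.param v| ^ τ := by
  rcases eq_or_ne u v with rfl | hne
  · rw [sub_self, abs_zero]
    positivity
  obtain ⟨n, heq, hdiff⟩ := P.exists_first_diff fun h => hne.symm (P.digits_injOn hv hu h)
  have hτ := P.τ_pos
  have hτ1 := P.τ_lt
  have hs := P.spacing_pos n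
  set m : ℝ := |((P.digits u n : ℕ) : ℝ) - (P.digits v n : ℕ)| with hm
  have hm1 : 1 ≤ m := by
    have h1 : ((P.digits u n : ℕ) : ℤ) - (P.digits v n : ℕ) ≠ 0 := by
      intro h'
      exact hdiff (Fin.ext (by omega))
    rw [hm]
    exact_mod_cast Int.one_le_abs h1
  have hmr : m ≤ 2 ^ P.r n := by
    have h1 : ((P.digits u n : ℕ) : ℝ) ≤ 2 ^ P.r n := by exact_mod_cast (P.digits u n).2.le
    have h2 : ((P.digits v n : ℕ) : ℝ) ≤ 2 ^ P.r n := by exact_mod_cast (P.digits v n).2.le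
    have h3 : (0 : ℝ) ≤ (P.digits u n : ℕ) := Nat.cast_nonneg _
    have h4 : (0 : ℝ) ≤ (P.digits v n : ℕ) := Nat.cast_nonneg _
    rw [hm, abs_le]
    constructor <;> linarith
  have hupper : (2 : ℝ) ^ P.a (n + 1) * |u - v| ≤ 2 * m := by
    have h2 := abs_sub_lt_of_floor (x := (2 : ℝ) ^ P.a (n + 1) * u)
      (y := (2 : ℝ) ^ P.a (n + 1) * v)
      (mul_nonneg (by positivity) hu.1) (mul_nonneg (by positivity) hv.1)
    rw [floor_succ, floor_succ, P.floor_eq_of_digits_eq hv hu heq, ← mul_sub, abs_mul,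
      abs_of_pos (by positivity)] at h2
    push_cast at h2
    rw [add_sub_add_left_eq_sub, ← hm] at h2
    linarith
  have hlower : m * P.spacing n / 2 ≤ |P.param u - P.param v| := by
    have h1 := P.abs_point_sub_le heq
    push_cast at h1
    have h2 := abs_sub_abs_le_abs_sub
      ((((P.digits u n : ℕ) : ℝ) - (P.digits v n : ℕ)) * P.spacing n) (P.param u - P.param v)
    rw [abs_sub_comm ((((P.digits u n : ℕ) : ℝ) - (P.digits v n : ℕ)) * P.spacing n), abs_mul,
      ← hm, abs_of_pos hs] at h2
    have h3 := P.gap_le_quarter n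
    have h4 : 2 * P.gap n * P.spacing n ≤ m * P.spacing n / 2 := by nlinarith
    have h5 : m * P.spacing n - |P.param u - P.param v| ≤ 2 * P.gap n * P.spacing n := h2.trans h1
    linarith
  have hmpos : 0 < m := by linarith
  have h1 : (m * P.spacing n / 2) ^ τ ≤ |P.param u - P.param v| ^ τ :=
    Real.rpow_le_rpow (by positivity) hlower hτ.le
  have h2 : (m * P.spacing n / 2) ^ τ = m ^ τ * (2 : ℝ) ^ (-(τ * (P.r n + P.e n + 1))) := by
    rw [mul_div_assoc, Real.mul_rpow hmpos.le (by positivity)]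
    congr 1
    have : P.spacing n / 2 = (2 : ℝ) ^ (-(P.r n + P.e n + 1 : ℝ)) := by
      have h3 : (P.r n + P.e n + 1 : ℝ) = ((P.r n + P.e n + 1 : ℕ) : ℝ) := by push_cast; ring
      rw [h3, ← half_pow_eq, spacing, pow_succ]
      ring
    rw [this, ← Real.rpow_mul (by norm_num)]
    congr 1
    ring
  have h3 : m ≤ m ^ τ * (2 : ℝ) ^ (P.r n * (1 - τ)) := by
    have h4 : m = m ^ τ * m ^ (1 - τ) := by
      rw [← Real.rpow_add hmpos, add_sub_cancel, Real.rpow_one]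
    have h5 : m ^ (1 - τ) ≤ (2 : ℝ) ^ (P.r n * (1 - τ)) := by
      rw [Real.rpow_mul (by norm_num), Real.rpow_natCast]
      exact Real.rpow_le_rpow hmpos.le hmr (by linarith)
    calc m = m ^ τ * m ^ (1 - τ) := h4
      _ ≤ _ := by gcongr
  -- In exponents of `2` this asks for `τ * e n + τ ≤ a n + 2`, which follows from `mul_e_le` and `τ
  -- < 1`; the constant `8` is what makes it fit.
  have h6 : 2 * (2 : ℝ) ^ (P.r n * (1 - τ)) ≤
      (2 : ℝ) ^ P.a (n + 1) * (8 * (2 : ℝ) ^ (-(τ * (P.r n + P.e n + 1)))) := by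
    have e8 : (8 : ℝ) = (2 : ℝ) ^ (3 : ℝ) := by norm_num
    have e2 : 2 * (2 : ℝ) ^ (P.r n * (1 - τ)) = (2 : ℝ) ^ (1 + P.r n * (1 - τ)) := by
      rw [Real.rpow_add (by norm_num), Real.rpow_one]
    rw [e2, e8, ← Real.rpow_natCast, ← Real.rpow_add (by norm_num), ← Real.rpow_add (by norm_num)]
    refine Real.rpow_le_rpow_of_exponent_le (by norm_num) ?_
    have := P.mul_e_le n
    rw [a_succ]
    push_cast
    nlinarith
  have hA : (0 : ℝ) < 2 ^ P.a (n + 1) := by positivity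
  rw [← mul_le_mul_iff_right₀ hA]
  calc (2 : ℝ) ^ P.a (n + 1) * |u - v| ≤ 2 * m := hupper
    _ ≤ 2 * (m ^ τ * (2 : ℝ) ^ (P.r n * (1 - τ))) := by gcongr
    _ = m ^ τ * (2 * (2 : ℝ) ^ (P.r n * (1 - τ))) := by ring
    _ ≤ m ^ τ * ((2 : ℝ) ^ P.a (n + 1) * (8 * (2 : ℝ) ^ (-(τ * (P.r n + P.e n + 1))))) := by
        gcongr
    _ = (2 : ℝ) ^ P.a (n + 1) * (8 * (m * P.spacing n / 2) ^ τ) := by rw [h2]; ring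
    _ ≤ _ := by gcongr

end CantorParams

/-! ### The allowed heights. -/

namespace ScaleData

variable {C : Set ℝ} {M : ℕ} (D : ScaleData C M)

/-- The heights that the lines must avoid. -/
def forbidden (i : ℕ) : Set ℝ := {z | ∃ k : ℤ, |z - k * D.ρ i| < 8 * D.ε i * D.ρ i}

def heights : Set ℝ := Icc 0 1 \ ⋃ i, D.forbidden i

theorem isOpen_forbidden (i : ℕ) : IsOpen (D.forbidden i) := by
  have : D.forbidden i = ⋃ k : ℤ, {z | |z - k * D.ρ i| < 8 * D.ε i * D.ρ i} := by
    ext z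
    simp [forbidden]
  rw [this]
  exact isOpen_iUnion fun k => isOpen_lt (by fun_prop) continuous_const

theorem isCompact_heights : IsCompact D.heights :=
  isCompact_Icc.diff (isOpen_iUnion D.isOpen_forbidden)

/-- `1 / ρ i` is an integer `N`, and `ε i ≤ 1 / 8` leaves only the centres `0, ρ i, ..., N * ρ i`;
the factor `32` comes from `(N + 1) * ρ i ≤ 2`. -/
theorem volume_forbidden_le (i : ℕ) (h : D.ε i ≤ 1 / 8) :
    volume (D.forbidden i ∩ Icc 0 1) ≤ 32 * ENNReal.ofReal (D.ε i) := by
  have hρ := D.ρ_pos i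
  have hε := D.ε_pos i
  set N : ℕ := D.A i * D.S i with hN
  have hNρ : (N : ℝ) * D.ρ i = 1 := by
    have := D.A_cast_pos i
    have := D.S_cast_pos i
    rw [hN, ρ]
    push_cast
    field_simp
  have hN1 : (1 : ℝ) ≤ N := by exact_mod_cast Nat.mul_pos (D.A_pos i) (D.S_pos i)
  have hcover : D.forbidden i ∩ Icc 0 1 ⊆
      ⋃ k ∈ Finset.range (N + 1), Metric.ball ((k : ℝ) * D.ρ i) (8 * D.ε i * D.ρ i) := by
    rintro z ⟨⟨k, hk⟩, hz0, hz1⟩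
    have h1 : |z - k * D.ρ i| < D.ρ i := by nlinarith
    rw [abs_lt] at h1
    have h2 : (-1 : ℝ) < k := by
      by_contra! h'
      nlinarith
    have h3 : (k : ℝ) < N + 1 := by
      by_contra! h'
      nlinarith
    have h4 : (-1 : ℤ) < k := by exact_mod_cast h2
    have h5 : k < N + 1 := by exact_mod_cast h3
    lift k to ℕ using by omega
    simp only [mem_iUnion, Finset.mem_range, Metric.mem_ball, Real.dist_eq]
    exact ⟨k, by omega, by exact_mod_cast hk⟩
  calc volume (D.forbidden i ∩ Icc 0 1)
      ≤ ∑ k ∈ Finset.range (N + 1),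
        volume (Metric.ball ((k : ℝ) * D.ρ i) (8 * D.ε i * D.ρ i)) :=
        (measure_mono hcover).trans (measure_biUnion_finset_le _ _)
    _ = ENNReal.ofReal ((N + 1) * (2 * (8 * D.ε i * D.ρ i))) := by
        simp only [Real.volume_ball, Finset.sum_const, Finset.card_range, nsmul_eq_mul]
        rw [← ENNReal.ofReal_natCast, ← ENNReal.ofReal_mul (Nat.cast_nonneg _)]
        push_cast
        rfl
    _ ≤ ENNReal.ofReal (32 * D.ε i) := by
        refine ENNReal.ofReal_le_ofReal ?_
        have h1 : ((N : ℝ) + 1) * D.ρ i ≤ 2 := by nlinarith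
        calc ((N : ℝ) + 1) * (2 * (8 * D.ε i * D.ρ i)) = 16 * D.ε i * ((N + 1) * D.ρ i) := by ring
          _ ≤ 16 * D.ε i * 2 := by gcongr
          _ = 32 * D.ε i := by ring
    _ = 32 * ENNReal.ofReal (D.ε i) := by
        rw [ENNReal.ofReal_mul (by norm_num)]
        norm_num

theorem volume_heights_ne_zero (h : ∑' i, ENNReal.ofReal (D.ε i) ≤ ENNReal.ofReal (1 / 64)) :
    volume D.heights ≠ 0 := by
  have hε : ∀ i, D.ε i ≤ 1 / 8 := fun i => by
    have h1 := (ENNReal.le_tsum i).trans h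
    rw [ENNReal.ofReal_le_ofReal_iff (by norm_num)] at h1
    linarith
  intro h0
  have h1 : volume (⋃ i, D.forbidden i ∩ Icc 0 1) ≤ ENNReal.ofReal (1 / 2) := by
    refine (measure_iUnion_le _).trans
      ((ENNReal.tsum_le_tsum fun i => D.volume_forbidden_le i (hε i)).trans ?_)
    rw [ENNReal.tsum_mul_left]
    refine (mul_le_mul_right h 32).trans (le_of_eq ?_)
    rw [show (32 : ENNReal) = ENNReal.ofReal 32 by norm_num, ← ENNReal.ofReal_mul (by norm_num)]
    norm_num
  have h2 : Icc (0 : ℝ) 1 ⊆ D.heights ∪ ⋃ i, D.forbidden i ∩ Icc 0 1 := by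
    intro z hz
    by_cases hf : z ∈ ⋃ i, D.forbidden i
    · obtain ⟨i, hi⟩ := mem_iUnion.1 hf
      exact Or.inr (mem_iUnion.2 ⟨i, hi, hz⟩)
    · exact Or.inl ⟨hz, hf⟩
  have h3 := (measure_mono h2).trans (measure_union_le (μ := volume) _ _)
  rw [h0, zero_add, Real.volume_Icc] at h3
  have h4 := h3.trans h1
  rw [ENNReal.ofReal_le_ofReal_iff (by norm_num)] at h4
  norm_num at h4

theorem add_mul_slope_notMem_heights {c c' : ℝ} (hc : c ∈ C) (hc' : c' ∈ C) {i : ℕ}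
    (h : |c' - c - D.μ i| ≤ D.ε i * |D.μ i|) (y : ℝ) : y + (c' - c) * D.slope y ∉ D.heights :=
  fun hy => hy.2 (mem_iUnion.2 ⟨i, D.exists_abs_sub_lt hc hc' h y⟩)

end ScaleData

/-! ### The projective map. -/

/-- A projective map, which turns parallel lines into concurrent ones. -/
noncomputable def projMap (p : ℝ × ℝ) : Plane := !₂[1 / (1 + p.1), p.2 / (1 + p.1)]

/-- The unit vector of slope `b`. -/
noncomputable def slopeDir (b : ℝ) : Plane := !₂[1 / √(1 + b ^ 2), b / √(1 + b ^ 2)]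

@[simp] theorem projMap_zero (p : ℝ × ℝ) : projMap p 0 = 1 / (1 + p.1) := rfl

@[simp] theorem projMap_one (p : ℝ × ℝ) : projMap p 1 = p.2 / (1 + p.1) := rfl

@[simp] theorem slopeDir_zero (b : ℝ) : slopeDir b 0 = 1 / √(1 + b ^ 2) := rfl

@[simp] theorem slopeDir_one (b : ℝ) : slopeDir b 1 = b / √(1 + b ^ 2) := rfl

theorem slopeDir_mem (b : ℝ) : slopeDir b ∈ unitCircle := by
  rw [unitCircle, mem_sphere_zero_iff_norm, EuclideanSpace.norm_eq, Real.sqrt_eq_one,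
    Fin.sum_univ_two, slopeDir_zero, slopeDir_one, Real.norm_eq_abs, Real.norm_eq_abs, sq_abs,
    sq_abs, div_pow, div_pow, Real.sq_sqrt (by positivity)]
  have : (1 + b ^ 2) ≠ 0 := by positivity
  field_simp

theorem Plane.dist_le (x y : Plane) : dist x y ≤ |x 0 - y 0| + |x 1 - y 1| := by
  rw [EuclideanSpace.dist_eq, Fin.sum_univ_two, Real.dist_eq, Real.dist_eq]
  refine Real.sqrt_le_iff.2 ⟨by positivity, ?_⟩
  have := mul_nonneg (abs_nonneg (x 0 - y 0)) (abs_nonneg (x 1 - y 1))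
  nlinarith

theorem Plane.abs_sub_le_dist (x y : Plane) (i : Fin 2) : |x i - y i| ≤ dist x y := by
  rw [← Real.dist_eq]
  exact PiLp.lipschitzWith_ofLp 2 _ |>.dist_le_mul x y |>.trans' (dist_le_pi_dist _ _ i) |>.trans
    (by simp)

theorem dist_projMap_le {p p' : ℝ × ℝ} (hp : 0 ≤ p.1) (hp' : 0 ≤ p'.1) (hy : p.2 ∈ Icc (0 : ℝ) 1) :
    dist (projMap p) (projMap p') ≤ 2 * |p.1 - p'.1| + |p.2 - p'.2| := by
  obtain ⟨c, y⟩ := p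
  obtain ⟨c', y'⟩ := p'
  simp only at hp hp' hy ⊢
  have h1 : |1 / (1 + c) - 1 / (1 + c')| ≤ |c - c'| := by
    have : 1 / (1 + c) - 1 / (1 + c') = (c' - c) / ((1 + c) * (1 + c')) := by
      field_simp; ring
    rw [this, abs_div, abs_of_pos (by positivity : 0 < (1 + c) * (1 + c')), abs_sub_comm]
    exact div_le_self (abs_nonneg _) (by nlinarith)
  have h2 : |y / (1 + c) - y' / (1 + c')| ≤ |c - c'| + |y - y'| := by
    have : y / (1 + c) - y' / (1 + c')
        = y * (1 / (1 + c) - 1 / (1 + c')) + (y - y') * (1 / (1 + c')) := by ring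
    rw [this]
    refine (abs_add_le _ _).trans ?_
    rw [abs_mul, abs_mul, abs_of_nonneg hy.1, abs_of_pos (by positivity : 0 < 1 / (1 + c'))]
    have h3 : 1 / (1 + c') ≤ 1 := by
      rw [div_le_one (by positivity)]; linarith
    have h4 := mul_le_mul hy.2 h1 (abs_nonneg _) (by norm_num)
    have h5 := mul_le_mul_of_nonneg_left h3 (abs_nonneg (y - y'))
    linarith
  refine (Plane.dist_le _ _).trans ?_
  simp only [projMap_zero, projMap_one]
  linarith

theorem abs_fst_sub_le {p p' : ℝ × ℝ} (hp : p.1 ∈ Icc (0 : ℝ) 2) (hp' : p'.1 ∈ Icc (0 : ℝ) 2) :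
    |p.1 - p'.1| ≤ 9 * dist (projMap p) (projMap p') := by
  obtain ⟨c, y⟩ := p
  obtain ⟨c', y'⟩ := p'
  obtain ⟨h0, h2⟩ := hp
  obtain ⟨h0', h2'⟩ := hp'
  simp only at h0 h2 h0' h2' ⊢
  have h1 := Plane.abs_sub_le_dist (projMap (c, y)) (projMap (c', y')) 0
  simp only [projMap_zero] at h1
  have : c - c' = ((1 + c) * (1 + c')) * -(1 / (1 + c) - 1 / (1 + c')) := by
    field_simp; ring
  rw [this, abs_mul, abs_neg, abs_of_pos (by positivity)]
  have h3 : (1 + c) * (1 + c') ≤ 9 := by nlinarith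
  gcongr

theorem abs_snd_sub_le {p p' : ℝ × ℝ} (hp : p.1 ∈ Icc (0 : ℝ) 2) (hp' : p'.1 ∈ Icc (0 : ℝ) 2)
    (hy' : p'.2 ∈ Icc (0 : ℝ) 1) : |p.2 - p'.2| ≤ 12 * dist (projMap p) (projMap p') := by
  have h1 := abs_fst_sub_le hp hp'
  have h2 := Plane.abs_sub_le_dist (projMap p) (projMap p') 1
  obtain ⟨c, y⟩ := p
  obtain ⟨c', y'⟩ := p'
  obtain ⟨h0, h2c⟩ := hp
  obtain ⟨h0', h2c'⟩ := hp'
  obtain ⟨hy0, hy1⟩ := hy'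
  simp only [projMap_one] at h0 h2c h0' h2c' hy0 hy1 h1 h2 ⊢
  have : y - y' = (1 + c) * (y / (1 + c) - y' / (1 + c')) + y' / (1 + c') * (c - c') := by
    field_simp; ring
  rw [this]
  refine (abs_add_le _ _).trans ?_
  rw [abs_mul, abs_mul, abs_of_pos (by positivity : 0 < 1 + c),
    abs_of_nonneg (by positivity : 0 ≤ y' / (1 + c'))]
  have h3 : y' / (1 + c') ≤ 1 := by
    rw [div_le_one (by positivity)]; linarith
  have h4 := mul_le_mul (by linarith : 1 + c ≤ 3) h2 (abs_nonneg _) (by norm_num)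
  have h5 := mul_le_mul h3 h1 (abs_nonneg _) (by norm_num)
  linarith

theorem continuousOn_projMap : ContinuousOn projMap {p | 0 ≤ p.1} := by
  have h : ∀ p ∈ {p : ℝ × ℝ | 0 ≤ p.1}, 1 + p.1 ≠ 0 := fun p hp => by
    have : 0 ≤ p.1 := hp
    positivity
  have h1 : ContinuousOn (fun p : ℝ × ℝ => (![1 / (1 + p.1), p.2 / (1 + p.1)] : Fin 2 → ℝ))
      {p | 0 ≤ p.1} := by
    rw [continuousOn_pi]
    intro i
    fin_cases i
    · exact ContinuousOn.div (by fun_prop) (by fun_prop) h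
    · exact ContinuousOn.div (by fun_prop) (by fun_prop) h
  exact (PiLp.continuous_toLp 2 _).comp_continuousOn h1

theorem measurable_projMap : Measurable projMap := by
  have h1 : Measurable (fun p : ℝ × ℝ => (![1 / (1 + p.1), p.2 / (1 + p.1)] : Fin 2 → ℝ)) := by
    rw [measurable_pi_iff]
    intro i
    fin_cases i
    · exact Measurable.div (by fun_prop) (by fun_prop)
    · exact Measurable.div (by fun_prop) (by fun_prop)
  exact (PiLp.continuous_toLp 2 _).measurable.comp h1

/-- A point of the line through `projMap (c, y)` that is the image of `(c', y')` comes from the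
line through `(c, y)` in the source. -/
theorem eq_add_mul_of_mem_line {c y c' y' a : ℝ} (hc : 0 ≤ c) (hc' : 0 ≤ c')
    (h : projMap (c', y') ∈ lineThrough (projMap (c, y)) (slopeDir (y - (1 + c) * a))) :
    y' = y + (c' - c) * a := by
  set b := y - (1 + c) * a with hb
  rw [lineThrough, SetLike.mem_coe, AffineSubspace.mem_mk', vsub_eq_sub,
    Submodule.mem_span_singleton] at h
  obtain ⟨s, hs⟩ := h
  have h0 := congrArg (fun x : Plane => x 0) hs
  have h1 := congrArg (fun x : Plane => x 1) hs
  simp only [PiLp.smul_apply, PiLp.sub_apply, slopeDir_zero, slopeDir_one, projMap_zero,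
    projMap_one, smul_eq_mul] at h0 h1
  have h2 : y' / (1 + c') - y / (1 + c) = b * (1 / (1 + c') - 1 / (1 + c)) := by
    rw [← h0, ← h1]; ring
  have hc1 : 1 + c ≠ 0 := by positivity
  have hc1' : 1 + c' ≠ 0 := by positivity
  field_simp at h2
  refine mul_left_cancel₀ hc1 ?_
  rw [hb] at h2
  linarith

/-! ### The planar set and its measure. -/

namespace CantorParams

variable {τ : ℝ} (P : CantorParams τ) {M : ℕ} (D : ScaleData (range P.point) M)

/-- The projective image of the product of the Cantor set and the allowed heights. -/
def planarSet : Set Plane := projMap '' (range P.point ×ˢ D.heights)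

theorem isCompact_planarSet : IsCompact (P.planarSet D) := by
  refine ((isCompact_range P.continuous_point).prod D.isCompact_heights).image_of_continuousOn
    (continuousOn_projMap.mono ?_)
  rintro ⟨c, y⟩ ⟨⟨k, rfl⟩, -⟩
  exact (P.point_mem_Icc k).1

/-- Cover by images of cells of side about `width n`: at most `width n ^ (-τ)` columns, with `1 /
width n + 1` cells in each. -/
theorem hausdorffMeasure_planarSet_lt_top : μH[1 + τ] (P.planarSet D) < ⊤ := by
  choose V hV hcov using P.exists_cover
  let ι : ℕ → Type := fun n => {v // v ∈ V n} × Fin (2 ^ P.e n + 1)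
  let cell : ∀ n, ι n → Set Plane := fun n i =>
    projMap '' ((Icc i.1.1 (i.1.1 + 2 * P.width n) ∩ Icc 0 2) ×ˢ
      (Icc (i.2 * P.width n) ((i.2 + 1) * P.width n) ∩ Icc 0 1))
  have hτ := P.τ_pos
  have hdiam : ∀ n i, Metric.ediam (cell n i) ≤ ENNReal.ofReal (5 * P.width n) := by
    intro n i
    refine Metric.ediam_le ?_
    rintro _ ⟨p, ⟨⟨hp1, hp2⟩, hp3, hp4⟩, rfl⟩ _ ⟨p', ⟨⟨hp1', hp2'⟩, hp3', hp4'⟩, rfl⟩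
    rw [edist_dist]
    refine ENNReal.ofReal_le_ofReal ?_
    refine (dist_projMap_le hp2.1 hp2'.1 hp4).trans ?_
    have h1 : |p.1 - p'.1| ≤ 2 * P.width n := by
      rw [abs_le]
      constructor <;> linarith [hp1.1, hp1.2, hp1'.1, hp1'.2]
    have h2 : |p.2 - p'.2| ≤ P.width n := by
      rw [abs_le]
      constructor <;> linarith [hp3.1, hp3.2, hp3'.1, hp3'.2]
    linarith
  have hlim : Filter.Tendsto (fun n => ENNReal.ofReal (5 * P.width n)) Filter.atTop (nhds 0) := by
    have h1 : Filter.Tendsto P.width Filter.atTop (nhds 0) := P.summable_width.tendsto_atTop_zero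
    have h2 := ENNReal.tendsto_ofReal (h1.const_mul 5)
    simpa using h2
  have hcover : ∀ n, P.planarSet D ⊆ ⋃ i, cell n i := by
    rintro n _ ⟨⟨c, y⟩, ⟨hc, hy⟩, rfl⟩
    have hw := P.width_pos n
    have h1 := hcov n hc
    simp only [mem_iUnion] at h1
    obtain ⟨v, hv, hcv⟩ := h1
    obtain ⟨k, rfl⟩ := hc
    have hy1 : y ∈ Icc (0 : ℝ) 1 := hy.1
    have hyw : 0 ≤ y / P.width n := div_nonneg hy1.1 hw.le
    have hfl := Nat.floor_le hyw
    have hfl' := Nat.lt_floor_add_one (y / P.width n)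
    have hlt : ⌊y / P.width n⌋₊ < 2 ^ P.e n + 1 := by
      refine Nat.lt_succ_of_le (Nat.floor_le_of_le ?_)
      push_cast
      rw [div_le_iff₀ hw, width, ← mul_pow]
      norm_num
      exact hy1.2
    rw [le_div_iff₀ hw] at hfl
    rw [div_lt_iff₀ hw] at hfl'
    exact mem_iUnion.2 ⟨(⟨v, hv⟩, ⟨_, hlt⟩), _,
      ⟨⟨hcv, P.point_mem_Icc k⟩, ⟨hfl, hfl'.le⟩, hy1⟩, rfl⟩
  have hsum : ∀ n, ∑ i, Metric.ediam (cell n i) ^ (1 + τ) ≤ ENNReal.ofReal (2 * 5 ^ (1 + τ)) := by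
    intro n
    have hw := P.width_pos n
    have hw1 : P.width n ≤ 1 := (P.width_le n).trans (pow_le_one₀ (by norm_num) (by norm_num))
    calc ∑ i, Metric.ediam (cell n i) ^ (1 + τ)
        ≤ ∑ _i : ι n, ENNReal.ofReal ((5 * P.width n) ^ (1 + τ)) := by
          refine Finset.sum_le_sum fun i _ => ?_
          rw [← ENNReal.ofReal_rpow_of_pos (by positivity)]
          exact ENNReal.rpow_le_rpow (hdiam n i) (by linarith)
      _ = ENNReal.ofReal (((V n).card * (2 ^ P.e n + 1)) * (5 * P.width n) ^ (1 + τ)) := by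
          have hcard : Fintype.card (ι n) = (V n).card * (2 ^ P.e n + 1) := by
            simp [ι]
          rw [Finset.sum_const, Finset.card_univ, hcard, nsmul_eq_mul, ← ENNReal.ofReal_natCast,
            ← ENNReal.ofReal_mul (Nat.cast_nonneg _)]
          push_cast
          rfl
      _ ≤ ENNReal.ofReal (2 * 5 ^ (1 + τ)) := by
          refine ENNReal.ofReal_le_ofReal ?_
          have h1 : ((2 : ℝ) ^ P.e n + 1) * P.width n ≤ 2 := by
            have h2 : (2 : ℝ) ^ P.e n * P.width n = 1 := by
              rw [width, ← mul_pow]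
              norm_num
            linarith
          have h3 := hV n
          calc ((V n).card * ((2 : ℝ) ^ P.e n + 1)) * (5 * P.width n) ^ (1 + τ)
              = (((2 : ℝ) ^ P.e n + 1) * P.width n) * ((V n).card * P.width n ^ τ)
                * 5 ^ (1 + τ) := by
                rw [Real.mul_rpow (by norm_num) hw.le, Real.rpow_add hw, Real.rpow_one]
                ring
            _ ≤ 2 * 1 * 5 ^ (1 + τ) := by gcongr
            _ = _ := by ring
  refine (Measure.hausdorffMeasure_le_liminf_sum (1 + τ) (P.planarSet D) _ hlim cell
    (Filter.Eventually.of_forall hdiam) (Filter.Eventually.of_forall hcover)).trans_lt ?_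
  refine lt_of_le_of_lt (Filter.liminf_le_liminf (Filter.Eventually.of_forall hsum)) ?_
  rw [Filter.liminf_const]
  exact ENNReal.ofReal_lt_top

/-- The parametrization of the planar set by the unit square. -/
noncomputable def planarParam (p : ℝ × ℝ) : Plane := projMap (P.param p.1, p.2)

theorem measurable_planarParam : Measurable P.planarParam :=
  measurable_projMap.comp ((P.measurable_param.comp measurable_fst).prodMk measurable_snd)

theorem planarParam_mem {p : ℝ × ℝ} (hp : p.2 ∈ D.heights) : P.planarParam p ∈ P.planarSet D :=
  ⟨(P.param p.1, p.2), ⟨P.param_mem _, hp⟩, rfl⟩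

/-- A set of diameter `r` pulls back into a rectangle with sides of order `r ^ τ` and `r`, so the
mass distribution principle applies. This turns statements `μH[1 + τ]`-almost everywhere into
statements about almost every parameter. -/
theorem map_planarParam_absolutelyContinuous :
    ((volume.restrict (Ico (0 : ℝ) 1)).prod (volume.restrict D.heights)).map P.planarParam
      ≪ (μH[1 + τ] : Measure Plane) := by
  have hτ := P.τ_pos
  have hτ1 := P.τ_lt
  refine absolutelyContinuous_hausdorffMeasure_of_ediam (by linarith) _ 864 one_pos ?_
  intro s r hs hr _ hd
  have hdist : ∀ x ∈ s, ∀ y ∈ s, dist x y ≤ r := by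
    intro x hx y hy
    have h1 := (Metric.edist_le_ediam_of_mem hx hy).trans hd
    rwa [edist_dist, ENNReal.ofReal_le_ofReal_iff hr.le] at h1
  have hIcc : ∀ u, P.param u ∈ Icc (0 : ℝ) 2 := fun u => P.point_mem_Icc _
  have hmeas := P.measurable_planarParam hs.measurableSet
  rw [Measure.map_apply P.measurable_planarParam hs.measurableSet, Measure.prod_restrict,
    Measure.restrict_apply hmeas]
  set B := P.planarParam ⁻¹' s ∩ Ico 0 1 ×ˢ D.heights with hB
  have h1 : volume (Prod.fst '' B) ≤ ENNReal.ofReal (8 * (9 * r) ^ τ) := by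
    refine (Real.volume_le_diam _).trans (Metric.ediam_le ?_)
    rintro _ ⟨p, ⟨hps, hp1, hp2⟩, rfl⟩ _ ⟨p', ⟨hps', hp1', hp2'⟩, rfl⟩
    rw [edist_dist, Real.dist_eq]
    refine ENNReal.ofReal_le_ofReal ((P.abs_sub_le_param hp1 hp1').trans ?_)
    have h2 := abs_fst_sub_le (p := (P.param p.1, p.2)) (p' := (P.param p'.1, p'.2))
      (hIcc _) (hIcc _)
    have h3 := hdist _ hps _ hps'
    rw [planarParam, planarParam] at h3
    gcongr
    linarith
  have h2 : volume (Prod.snd '' B) ≤ ENNReal.ofReal (12 * r) := by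
    refine (Real.volume_le_diam _).trans (Metric.ediam_le ?_)
    rintro _ ⟨p, ⟨hps, hp1, hp2⟩, rfl⟩ _ ⟨p', ⟨hps', hp1', hp2'⟩, rfl⟩
    rw [edist_dist, Real.dist_eq]
    refine ENNReal.ofReal_le_ofReal ?_
    have h2 := abs_snd_sub_le (p := (P.param p.1, p.2)) (p' := (P.param p'.1, p'.2))
      (hIcc _) (hIcc _) hp2'.1
    have h3 := hdist _ hps _ hps'
    rw [planarParam, planarParam] at h3
    linarith
  calc (volume.prod volume) B
      ≤ (volume.prod volume) ((Prod.fst '' B) ×ˢ (Prod.snd '' B)) :=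
        measure_mono fun p hp => ⟨mem_image_of_mem _ hp, mem_image_of_mem _ hp⟩
    _ = volume (Prod.fst '' B) * volume (Prod.snd '' B) := Measure.prod_prod _ _
    _ ≤ ENNReal.ofReal (8 * (9 * r) ^ τ) * ENNReal.ofReal (12 * r) := by gcongr
    _ = ENNReal.ofReal (96 * 9 ^ τ * r ^ (1 + τ)) := by
        rw [← ENNReal.ofReal_mul (by positivity), Real.mul_rpow (by norm_num) hr.le,
          Real.rpow_add hr, Real.rpow_one]
        congr 1
        ring
    _ ≤ ENNReal.ofReal (864 * r ^ (1 + τ)) := by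
        refine ENNReal.ofReal_le_ofReal ?_
        have h3 : (9 : ℝ) ^ τ ≤ 9 := by
          simpa using Real.rpow_le_rpow_of_exponent_le (by norm_num : (1 : ℝ) ≤ 9) hτ1.le
        gcongr
        linarith
    _ = ((864 : NNReal) : ENNReal) * ENNReal.ofReal r ^ (1 + τ) := by
        rw [ENNReal.ofReal_mul (by norm_num), ENNReal.ofReal_rpow_of_pos hr]
        simp

/-- Through each point of the planar set there is a line that meets the set only there. -/
theorem planarSet_inter_line_subset
    (hdiff : ∀ c ∈ range P.point, ∀ c' ∈ range P.point, c ≠ c' →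
      ∃ i, |c' - c - D.μ i| ≤ D.ε i * |D.μ i|) {c : ℝ} (hc : c ∈ range P.point) (y : ℝ) :
    P.planarSet D ∩ lineThrough (projMap (c, y)) (slopeDir (y - (1 + c) * D.slope y))
      ⊆ {projMap (c, y)} := by
  rintro _ ⟨⟨⟨c', y'⟩, ⟨hc', hy'⟩, rfl⟩, hline⟩
  have h0 : ∀ c ∈ range P.point, 0 ≤ c := by
    rintro _ ⟨k, rfl⟩
    exact (P.point_mem_Icc k).1
  have h1 := eq_add_mul_of_mem_line (h0 c hc) (h0 c' hc') hline
  rcases eq_or_ne c c' with rfl | hne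
  · rw [sub_self, zero_mul, add_zero] at h1
    rw [h1]
    rfl
  · obtain ⟨i, hi⟩ := hdiff c hc c' hc' hne
    exact absurd (h1 ▸ hy') (D.add_mul_slope_notMem_heights hc hc' hi y)

end CantorParams

/-! ### Exceptional directions and conclusion. -/

/-- The slope `e 1 / e 0` is Lipschitz away from vertical directions, and `|b| ≤ 4` keeps `e 0 ≥ 1 /
√17 ≥ 1 / 5`. -/
theorem dimH_slopes_le (E : Set Plane) :
    dimH {b | b ∈ Icc (-4 : ℝ) 4 ∧ slopeDir b ∈ E} ≤ dimH E := by
  let q : Plane → ℝ := fun e => e 1 / e 0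
  let s : Set Plane := E ∩ {e | 1 / 5 ≤ e 0 ∧ |e 1| ≤ 1}
  have hlip : LipschitzOnWith 30 q s := by
    refine LipschitzOnWith.of_dist_le_mul ?_
    rintro e ⟨-, he0, he1⟩ f ⟨-, hf0, hf1⟩
    have hd0 := Plane.abs_sub_le_dist e f 0
    have hd1 := Plane.abs_sub_le_dist e f 1
    have hepos : 0 < e 0 := by linarith
    have hfpos : 0 < f 0 := by linarith
    have h5e : 1 / e 0 ≤ 5 := by
      rw [div_le_iff₀ hepos]; linarith
    have h5f : 1 / f 0 ≤ 5 := by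
      rw [div_le_iff₀ hfpos]; linarith
    have h1 : q e - q f = 1 / e 0 * ((e 1 - f 1) - f 1 * (1 / f 0) * (e 0 - f 0)) := by
      show e 1 / e 0 - f 1 / f 0 = _
      field_simp
      ring
    rw [Real.dist_eq, h1, abs_mul, abs_of_pos (by positivity : 0 < 1 / e 0)]
    have h2 : |(e 1 - f 1) - f 1 * (1 / f 0) * (e 0 - f 0)| ≤ 6 * dist e f := by
      refine (abs_sub _ _).trans ?_
      rw [abs_mul, abs_mul, abs_of_pos (by positivity : 0 < 1 / f 0)]
      have h3 : |f 1| * (1 / f 0) ≤ 1 * 5 := mul_le_mul hf1 h5f (by positivity) (by norm_num)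
      have h4 := mul_le_mul h3 hd0 (abs_nonneg _) (by norm_num)
      linarith
    have h6 := mul_le_mul h5e h2 (abs_nonneg _) (by norm_num)
    have h7 : ((30 : NNReal) : ℝ) = 30 := rfl
    rw [h7]
    linarith
  have hsub : {b | b ∈ Icc (-4 : ℝ) 4 ∧ slopeDir b ∈ E} ⊆ q '' s := by
    rintro b ⟨⟨hb1, hb2⟩, hbE⟩
    have hpos : 0 < √(1 + b ^ 2) := Real.sqrt_pos.2 (by positivity)
    refine ⟨slopeDir b, ⟨hbE, ?_, ?_⟩, ?_⟩
    · rw [slopeDir_zero]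
      refine one_div_le_one_div_of_le hpos ?_
      rw [Real.sqrt_le_iff]
      constructor <;> nlinarith
    · rw [slopeDir_one, abs_div, abs_of_pos hpos, div_le_one hpos]
      refine Real.abs_le_sqrt ?_
      linarith
    · show slopeDir b 1 / slopeDir b 0 = b
      rw [slopeDir_zero, slopeDir_one]
      field_simp
  exact (dimH_mono hsub).trans ((hlip.dimH_image_le).trans (dimH_mono inter_subset_left))

theorem not_admissible_of_lt_one {τ γ : ℝ} (h0 : 0 < τ) (h1 : τ < 1) (hγ : γ < 1) :
    ¬ Admissible (1 + τ) γ := by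
  intro hadm
  obtain ⟨M, hM1, hMγ⟩ : ∃ M : ℕ, 1 < M ∧ γ < 1 - 1 / (M : ℝ) := by
    obtain ⟨N, hN⟩ := exists_nat_gt (1 / (1 - γ))
    refine ⟨N + 2, by omega, ?_⟩
    have h2 : 0 < 1 - γ := by linarith
    have h3 : (1 : ℝ) / ((N + 2 : ℕ) : ℝ) < 1 - γ := by
      rw [div_lt_iff₀ h2] at hN
      rw [div_lt_iff₀ (by positivity)]
      push_cast
      nlinarith
    linarith
  obtain ⟨P⟩ := CantorParams.nonempty h0 h1
  obtain ⟨D, hε, hdiff⟩ := P.exists_scaleData M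
  obtain ⟨E, -, hEdim, hae⟩ := hadm (P.planarSet D) (P.isCompact_planarSet D)
    (P.hausdorffMeasure_planarSet_lt_top D)
  set E' : Set ℝ := {b | b ∈ Icc (-4 : ℝ) 4 ∧ slopeDir b ∈ E} with hE'
  have hd0 : 0 < 1 - 1 / (M : ℝ) := by
    have : (1 : ℝ) < M := by exact_mod_cast hM1
    rw [sub_pos, div_lt_one (by linarith)]
    exact this
  have hnull : μH[1 - 1 / (M : ℝ)] E' = 0 := by
    have hlt : dimH E' < (Real.toNNReal (1 - 1 / (M : ℝ)) : ENNReal) :=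
      ((dimH_slopes_le E).trans hEdim).trans_lt ((ENNReal.ofReal_lt_ofReal_iff hd0).2 hMγ)
    have := hausdorffMeasure_of_dimH_lt hlt
    rwa [Real.coe_toNNReal _ hd0.le] at this
  -- `E` need not be measurable; Fubini is applied to a measurable null hull instead.
  set F := toMeasurable μH[1 - 1 / (M : ℝ)] E' with hF
  have hFnull : μH[1 - 1 / (M : ℝ)] F = 0 := by rw [hF, measure_toMeasurable, hnull]
  set ν := (volume.restrict (Ico (0 : ℝ) 1)).prod (volume.restrict D.heights) with hν
  have hT : Measurable fun p : ℝ × ℝ => p.2 - (1 + P.param p.1) * D.slope p.2 :=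
    measurable_snd.sub ((measurable_const.add (P.measurable_param.comp measurable_fst)).mul
      (D.measurable_slope.comp measurable_snd))
  have hzero : ∀ᵐ p ∂ν, p.2 - (1 + P.param p.1) * D.slope p.2 ∉ F := by
    have hmeas := hT (measurableSet_toMeasurable μH[1 - 1 / (M : ℝ)] E')
    have h2 : ν {p | p.2 - (1 + P.param p.1) * D.slope p.2 ∈ F} = 0 := by
      -- Each vertical section is null, with `κ = 1 + c` in `[1, 3]`.
      refine (Measure.measure_prod_null hmeas).2 (Filter.Eventually.of_forall fun u => ?_)
      have h3 : |1 + P.param u| ≤ 3 := by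
        have h4 := P.point_mem_Icc (P.digits u)
        rw [abs_le]
        constructor <;> linarith [h4.1, h4.2, show P.param u = P.point (P.digits u) from rfl]
      exact Measure.absolutelyContinuous_of_le Measure.restrict_le_self
        (D.volume_preimage_eq_zero hM1 h3 hFnull)
    rw [ae_iff]
    simpa using h2
  have hmem : ∀ᵐ p ∂ν, p ∈ Ico (0 : ℝ) 1 ×ˢ D.heights := by
    rw [hν, Measure.prod_restrict]
    exact ae_restrict_mem (measurableSet_Ico.prod D.isCompact_heights.measurableSet)
  have hline := ae_of_ae_map P.measurable_planarParam.aemeasurable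
    ((P.map_planarParam_absolutelyContinuous D).ae_le hae)
  -- At almost every parameter the singleton line has direction outside `E`, against admissibility;
  -- so `ν` would vanish.
  have hfalse : ∀ᵐ p ∂ν, False := by
    filter_upwards [hzero, hmem, hline] with p hp1 hp2 hp3
    refine hp1 (subset_toMeasurable _ _ ?_)
    have hy : p.2 ∈ Icc (0 : ℝ) 1 := hp2.2.1
    have hc := P.point_mem_Icc (P.digits p.1)
    change P.param p.1 ∈ Icc (0 : ℝ) 2 at hc
    refine ⟨?_, ?_⟩
    · have ha := D.abs_slope_le p.2
      have hb : |(1 + P.param p.1) * D.slope p.2| ≤ 3 * 1 := by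
        rw [abs_mul]
        refine mul_le_mul ?_ ha (abs_nonneg _) (by norm_num)
        rw [abs_le]
        constructor <;> linarith [hc.1, hc.2]
      have hb' := abs_le.1 hb
      constructor <;> linarith [hy.1, hy.2]
    · by_contra hnot
      have h2 := hp3 (P.planarParam_mem D hp2.2) _ ⟨slopeDir_mem _, hnot⟩
      have h3 := encard_le_encard
        (P.planarSet_inter_line_subset D hdiff (P.param_mem p.1) p.2)
      rw [encard_singleton] at h3
      have h4 := h2.trans h3
      exact absurd h4 (by norm_num)
  have hν0 : ν univ = 0 := by
    have := ae_iff.1 hfalse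
    simpa using this
  rw [hν, ← univ_prod_univ, Measure.prod_prod, Measure.restrict_apply_univ,
    Measure.restrict_apply_univ, Real.volume_Ico, mul_eq_zero] at hν0
  rcases hν0 with h | h
  · norm_num at h
  · exact D.volume_heights_ne_zero hε h

theorem dimH_unitCircle_le : dimH unitCircle ≤ 1 := by
  let f : ℝ → Plane := fun θ => WithLp.toLp 2 ![Real.cos θ, Real.sin θ]
  have hf : ContDiff ℝ 1 f := by
    rw [contDiff_euclidean]
    intro i
    fin_cases i
    · exact Real.contDiff_cos
    · exact Real.contDiff_sin
  have hsub : unitCircle ⊆ range f := by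
    intro e he
    rw [unitCircle, mem_sphere_zero_iff_norm, EuclideanSpace.norm_eq, Real.sqrt_eq_one,
      Fin.sum_univ_two, Real.norm_eq_abs, Real.norm_eq_abs, sq_abs, sq_abs] at he
    have hz : ‖(⟨e 0, e 1⟩ : ℂ)‖ = 1 := by
      rw [Complex.norm_def, Complex.normSq_mk, Real.sqrt_eq_one]
      linarith
    refine ⟨Complex.arg ⟨e 0, e 1⟩, ?_⟩
    have hc := Complex.norm_mul_cos_arg ⟨e 0, e 1⟩
    have hs := Complex.norm_mul_sin_arg ⟨e 0, e 1⟩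
    rw [hz, one_mul] at hc hs
    ext i
    fin_cases i
    · exact hc
    · exact hs
  refine (dimH_mono hsub).trans ?_
  simpa using hf.dimH_range_le

theorem admissible_one (t : ℝ) : Admissible t 1 := fun K _ _ =>
  ⟨unitCircle, subset_rfl, by simpa using dimH_unitCircle_le,
    Filter.Eventually.of_forall fun _ _ e he => absurd he.1 he.2⟩

/-- A slice with at most one point has dimension `0 < t - 1`. -/
theorem UniformSliceEstimate.admissible {t : ℝ} (ht : 1 < t) (h : UniformSliceEstimate t) :
    Admissible t (2 - t) := by
  intro K hK hfin
  rcases eq_or_ne (μH[t] K) 0 with h0 | h0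
  · refine ⟨∅, empty_subset _, by simp, ?_⟩
    filter_upwards [measure_eq_zero_iff_ae_notMem.1 h0] with x hx hxK
    exact absurd hxK hx
  · obtain ⟨E, hE, hdim, hae⟩ := h K hK (pos_iff_ne_zero.2 h0) hfin
    refine ⟨E, hE, hdim, ?_⟩
    filter_upwards [hae] with x hx hxK e he
    have h1 := hx hxK e he
    by_contra hlt
    have h2 : (K ∩ lineThrough x e).encard ≤ 1 := by
      rw [not_le] at hlt
      exact Order.le_of_lt_add_one (by rwa [one_add_one_eq_two])
    rw [(encard_le_one_iff_subsingleton.1 h2).dimH_zero, nonpos_iff_eq_zero,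
      ENNReal.ofReal_eq_zero] at h1
    linarith

theorem propositionB1 (t : ℝ) (ht : t ∈ Set.Ioo (1 : ℝ) 2) :
    gammaExponent t = 1 ∧ ¬ UniformSliceEstimate t := by
  have hnot : ∀ γ < 1, ¬ Admissible t γ := fun γ hγ => by
    have := not_admissible_of_lt_one (τ := t - 1) (by linarith [ht.1]) (by linarith [ht.2]) hγ
    rwa [add_sub_cancel] at this
  refine ⟨?_, fun h => hnot (2 - t) (by linarith [ht.1]) (h.admissible ht.1)⟩
  have hset : {γ : ℝ | γ ∈ Icc (0 : ℝ) 1 ∧ Admissible t γ} = {1} := by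
    ext γ
    refine ⟨fun ⟨hγ, hadm⟩ => ?_, ?_⟩
    · exact le_antisymm hγ.2 (not_lt.1 fun hlt => hnot γ hlt hadm)
    · rintro rfl
      exact ⟨⟨zero_le_one, le_rfl⟩, admissible_one t⟩
  rw [gammaExponent, hset, csInf_singleton]
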